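/- **Setting.** An instance of metric uncapacitated facility location (UFL) with penalties consists of a finite set $F$ of facilities and a finite set $C$ of clients, located at points of a (pseudo)metric space (write $d_{i,j}$ for the distance between facility $i$ and client $j$), opening costs $f_i \ge 0$ ($i\in F$) and penalties $p_j \ge 0$ ($j\in C$). A feasible solution $S$ is a set of opened facilities together with a choice, for every client, of either an opened facility to which it is connected or rejection. Its opening cost $F_S$ is the sum of $f_i$ over opened facilities, its connection cost $D_S$ is the sum of the distances of connected clients to their facilities, its penalty cost $P_S$ is the sum of $p_j$ over rejected clients, and its cost is $F_S + D_S + P_S$. **The penalized JMS algorithm.** Let $[x]^+=\max\{x,0\}$. Initially the time and all budgets $\alpha_j$ are $0$, all clients are active and unconnected, and all facilities are unopened. At every moment client $j$ offers to facility $i$ the amount $[\alpha_j-d_{i,j}]^+$ if $j$ is not connected, and $[d_{i',j}-d_{i,j}]^+$ if $j$ is connected to $i'$. While there is an active client, the time and the budgets of all active clients are increased simultaneously and uniformly until the first moment (possibly the current one) at which one of the following events happens, and one such event is executed (ties are broken arbitrarily): 1. for some unopened facility $i$ the offers of all clients (active and inactive) to $i$ sum to $f_i$: open $i$, (re-)connect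 to $i$ all clients with a positive offer to $i$, and make them inactive; 2. for some active client $j$ and opened facility $i$, $\alpha_j=d_{i,j}$: connect $j$ to $i$ and make $j$ inactive; 3. for some active client $j$, $\alpha_j=p_j$: make $j$ inactive. When no client is active, return the opened facilities with the current connections; the unconnected clients are rejected and their penalties are paid. **Corollary.** The penalized JMS algorithm is a $(1.11,1.78)$ bifactor approximation algorithm for metric UFL with penalties. That is, on every instance and for every way of breaking ties, as long as there is an active client a next iteration can be performed; the algorithm stops after at most $|F|+|C|$ iterations; and the solution $A$ that it returns is feasible and satisfies, for every feasible solution $S$ (in particular for an optimal one), $$F_A+D_A+P_A \;\le\; 1.11\,F_S + 1.78\,(D_S+P_S).$$ -/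

import Mathlib

/-- An instance of metric uncapacitated facility location with penalties: facilities `F` and
clients `C` are placed at (not necessarily distinct) points of a (pseudo)metric space `X`. -/
structure FLPInstance (X F C : Type*) [PseudoMetricSpace X] where
  facilityLoc : F → X
  clientLoc : C → X
  openCost : F → ℝ
  penalty : C → ℝ
  openCost_nonneg : ∀ i, 0 ≤ openCost i
  penalty_nonneg : ∀ j, 0 ≤ penalty j

/-- A candidate solution: a finite set of opened facilities and, for every client, the facility it
is connected to (`none` if the client is rejected). -/
structure FLPSolution (F C : Type*) where
  opened : Finset F
  assign : C → Option F

/-- Clients are connected to opened facilities only. -/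
def FLPSolution.Feasible {F C : Type*} (S : FLPSolution F C) : Prop :=
  ∀ j i, S.assign j = some i → i ∈ S.opened

/-- A configuration of the penalized JMS algorithm. -/
structure JMSState (F C : Type*) where
  time : ℝ
  budget : C → ℝ
  active : Finset C
  opened : Finset F
  conn : C → Option F

/-- The solution held by a configuration: the opened facilities with the current connections;
the clients that did not get connected pay their penalties. -/
def JMSState.solution {F C : Type*} (s : JMSState F C) : FLPSolution F C where
  opened := s.opened
  assign := s.conn

/-- Time goes on by `δ`: the budgets of exactly the active clients grow by `δ`. -/
noncomputable def JMSState.advance {F C : Type*} [DecidableEq C] (s : JMSState F C) (δ : ℝ) :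
    JMSState F C where
  time := s.time + δ
  budget := fun j => if j ∈ s.active then s.budget j + δ else s.budget j
  active := s.active
  opened := s.opened
  conn := s.conn

/-- Initially all budgets are `0`, all clients are active and unconnected, and no facility is
open. -/
noncomputable def JMSState.init (F C : Type*) [Fintype C] : JMSState F C where
  time := 0
  budget := fun _ => 0
  active := Finset.univ
  opened := ∅
  conn := fun _ => none

namespace FLPInstance

variable {X F C : Type*} [PseudoMetricSpace X]

/-- The distance between facility `i` and client `j`. -/
noncomputable def d (I : FLPInstance X F C) (i : F) (j : C) : ℝ :=
  dist (I.facilityLoc i) (I.clientLoc j)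

/-- Total opening cost of a solution. -/
noncomputable def openingCost (I : FLPInstance X F C) (S : FLPSolution F C) : ℝ :=
  ∑ i ∈ S.opened, I.openCost i

/-- Total connection cost of a solution. -/
noncomputable def connectionCost [Fintype C] (I : FLPInstance X F C) (S : FLPSolution F C) : ℝ :=
  ∑ j, match S.assign j with
    | none => 0
    | some i => I.d i j

/-- Total penalty cost of a solution. -/
noncomputable def penaltyCost [Fintype C] (I : FLPInstance X F C) (S : FLPSolution F C) : ℝ :=
  ∑ j, match S.assign j with
    | none => I.penalty j
    | some _ => 0

/-- Total cost of a solution. -/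
noncomputable def cost [Fintype C] (I : FLPInstance X F C) (S : FLPSolution F C) : ℝ :=
  I.openingCost S + I.connectionCost S + I.penaltyCost S

/-- The amount that client `j` offers to facility `i`. -/
noncomputable def offer (I : FLPInstance X F C) (s : JMSState F C) (i : F) (j : C) : ℝ :=
  match s.conn j with
  | none => max (s.budget j - I.d i j) 0
  | some i' => max (I.d i' j - I.d i j) 0

/-- Opening facility `i`: all clients with a positive offer towards `i` are (re-)connected to it
and become inactive. -/
noncomputable def openFacility [DecidableEq F] (I : FLPInstance X F C) (s : JMSState F C) (i : F) :
    JMSState F C where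
  time := s.time
  budget := s.budget
  active := s.active.filter (fun j => ¬ 0 < I.offer s i j)
  opened := insert i s.opened
  conn := fun j => if 0 < I.offer s i j then some i else s.conn j

/-- `I.Event s s'`: one of the three events happens in `s`, and its execution leads to `s'`. -/
inductive Event [DecidableEq F] [DecidableEq C] [Fintype C] (I : FLPInstance X F C)
    (s : JMSState F C) : JMSState F C → Prop
  /-- a facility opens -/
  | facilityOpens (i : F) (hi : i ∉ s.opened) (hoffer : ∑ j, I.offer s i j = I.openCost i) :
      Event I s (I.openFacility s i)
  /-- an active client connects to an opened facility -/
  | clientConnects (j : C) (i : F) (hj : j ∈ s.active) (hi : i ∈ s.opened)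
      (hd : s.budget j = I.d i j) :
      Event I s { s with active := s.active.erase j, conn := Function.update s.conn j (some i) }
  /-- the potential of an active client runs out -/
  | potentialRunsOut (j : C) (hj : j ∈ s.active) (hp : s.budget j = I.penalty j) :
      Event I s { s with active := s.active.erase j }

/-- One iteration of the while loop: there is an active client, the time is increased until the
first moment at which some event happens, and one of the events of that moment (ties are broken
arbitrarily) is executed. -/
def Step [DecidableEq F] [DecidableEq C] [Fintype C] (I : FLPInstance X F C)
    (s s' : JMSState F C) : Prop :=
  s.active.Nonempty ∧
    ∃ δ : ℝ, 0 ≤ δ ∧ (∀ ε : ℝ, 0 ≤ ε → ε < δ → ∀ s'', ¬ I.Event (s.advance ε) s'') ∧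
      I.Event (s.advance δ) s'

/-- `I.Reaches n s`: some execution of the penalized JMS algorithm is in configuration `s` after
`n` iterations of the while loop. -/
inductive Reaches [DecidableEq F] [DecidableEq C] [Fintype C] (I : FLPInstance X F C) :
    ℕ → JMSState F C → Prop
  | init : Reaches I 0 (JMSState.init F C)
  | step {n : ℕ} {s s' : JMSState F C} (h : Reaches I n s) (hs : I.Step s s') :
      Reaches I (n + 1) s'

/-- `I.Returns S`: some execution of the penalized JMS algorithm terminates (no client is active
any more) and returns the solution `S`. -/
def Returns [DecidableEq F] [DecidableEq C] [Fintype C] (I : FLPInstance X F C)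
    (S : FLPSolution F C) : Prop :=
  ∃ n s, I.Reaches n s ∧ s.active = ∅ ∧ S = s.solution

end FLPInstance

/-! The proof is by dual fitting. Money is conserved: a client's budget pays for its connection and
its contributions to openings, or equals its penalty, so the output costs exactly the sum of the
final budgets `α` (`Inv.cost_eq`). These are compared with `S` star by star (`sum_budget_le_cost`).
A client that `S` rejects has a budget of at most its penalty. For a facility of cost `f` and the
clients that `S` connects to it at distances `d`, one needs `∑ α ≤ 1.11 f + 1.78 ∑ d`.

Fix a star and a time `t`. As long as its facility is closed, the offers to it sum to at most `f`
(`OfferHistory`). A client `l` with `α l ≥ t` offers `t - d l`. A client `j` that stopped earlier is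
either connected, and then by the triangle inequality it offers at least `α l - d l - 2 d j` for
every such `l`, or it has given up, and then its offer is frozen at `α j - d j`. The frozen offers
are what penalties add to the classical analysis. Let `m t` be the largest `(α l - d l)⁺` over the
clients with `α l ≥ t`, and let `M = m 0`. If `α j + d j ≥ M`, the frozen offer is at least `M - 2 d
j`, as good as a connected one. Otherwise `sum_budget_le` replaces `j` by a client of budget `M - d
j` with a weight below one, chosen so that its offer `M - 2 d j` counts for exactly `(α j - d j)⁺`;
this does not decrease `∑ (α - 1.78 d)`.

The weighted clients, sorted by budget, fill the unit interval (`exists_arrangement`), which turns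
the bound into a continuous linear program independent of the number of clients.
`DualCertificate.integral_le` is weak duality for it, and `JMSCertificate.dualCertificate` is an
explicit piecewise dual solution of value `(1.11, 1.78)`. -/

namespace FLPInstance

/-! ### Invariants, progress and termination of the algorithm -/

section Algorithm

variable {X F C : Type*} [PseudoMetricSpace X]

/-- The service cost of a client in a connection state: nothing if it is unconnected. -/
noncomputable def connCost (I : FLPInstance X F C) (conn : C → Option F) (j : C) : ℝ :=
  match conn j with
  | none => 0
  | some i => I.d i j

/-- The budget of a client if it is connected, and nothing otherwise. -/
noncomputable def connBudget (s : JMSState F C) (j : C) : ℝ :=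
  match s.conn j with
  | none => 0
  | some _ => s.budget j

/-- The invariants of the penalized JMS algorithm. -/
structure Inv [Fintype C] (I : FLPInstance X F C) (s : JMSState F C) : Prop where
  time_nonneg : 0 ≤ s.time
  budget_active : ∀ j ∈ s.active, s.budget j = s.time
  budget_le_time : ∀ j, s.budget j ≤ s.time
  budget_le_penalty : ∀ j, s.budget j ≤ I.penalty j
  conn_active : ∀ j ∈ s.active, s.conn j = none
  conn_opened : ∀ j i, s.conn j = some i → i ∈ s.opened
  rejected : ∀ j, j ∉ s.active → s.conn j = none → s.budget j = I.penalty j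
  le_dist : ∀ j ∈ s.active, ∀ i ∈ s.opened, s.budget j ≤ I.d i j
  offers_le : ∀ i, i ∉ s.opened → ∑ j, I.offer s i j ≤ I.openCost i
  accounting : ∑ i ∈ s.opened, I.openCost i + ∑ j, I.connCost s.conn j = ∑ j, connBudget s j

lemma d_nonneg (I : FLPInstance X F C) (i : F) (j : C) : 0 ≤ I.d i j := dist_nonneg

/-- The path `i'`, `j`, `i`, `l`. It makes a client `j` connected to `i'` vouch for the budgets of
the clients `l` that stop no later than their distance to `i'`. -/
lemma d_le (I : FLPInstance X F C) (i i' : F) (j l : C) :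
    I.d i' l ≤ I.d i' j + I.d i j + I.d i l := by
  unfold d
  have h1 := dist_triangle4 (I.facilityLoc i') (I.clientLoc j) (I.facilityLoc i) (I.clientLoc l)
  rw [dist_comm (I.clientLoc j)] at h1
  exact h1

lemma offer_nonneg (I : FLPInstance X F C) (s : JMSState F C) (i : F) (j : C) :
    0 ≤ I.offer s i j := by
  unfold offer
  split <;> exact le_max_right _ _

lemma offer_of_none {I : FLPInstance X F C} {s : JMSState F C} {i : F} {j : C}
    (h : s.conn j = none) : I.offer s i j = max (s.budget j - I.d i j) 0 := by
  simp [offer, h]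

lemma offer_of_some {I : FLPInstance X F C} {s : JMSState F C} {i i' : F} {j : C}
    (h : s.conn j = some i') : I.offer s i j = max (I.d i' j - I.d i j) 0 := by
  simp [offer, h]

lemma inv_init [Fintype C] (I : FLPInstance X F C) : I.Inv (JMSState.init F C) where
  time_nonneg := le_rfl
  budget_active := fun _ _ => rfl
  budget_le_time := fun _ => le_rfl
  budget_le_penalty := fun j => I.penalty_nonneg j
  conn_active := fun _ _ => rfl
  conn_opened := fun j i h => by simp [JMSState.init] at h
  rejected := fun j h => by simp [JMSState.init] at h
  le_dist := fun j _ i h => by simp [JMSState.init] at h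
  offers_le := fun i _ => by
    have : ∀ j, I.offer (JMSState.init F C) i j = 0 := fun j => by
      simp [offer, JMSState.init, d_nonneg]
    simp [this, I.openCost_nonneg]
  accounting := by simp [JMSState.init, connCost, connBudget]

/-- The accounting invariant covers the connected clients; each remaining client stopped exactly at
its penalty. -/
lemma Inv.cost_eq [Fintype C] {I : FLPInstance X F C} {s : JMSState F C} (h : I.Inv s)
    (ha : s.active = ∅) : I.cost s.solution = ∑ j, s.budget j := by
  have h1 : ∀ j, s.budget j = connBudget s j +
      (match s.conn j with
        | none => I.penalty j
        | some _ => 0) := fun j => by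
    unfold connBudget
    cases hc : s.conn j with
    | none => simpa using h.rejected j (by simp [ha]) hc
    | some i => simp
  rw [Finset.sum_congr rfl fun j _ => h1 j, Finset.sum_add_distrib, ← h.accounting]
  rfl

/-- The history of the offers to the facility `i` up to the current time: for every past time `t`,
either `i` is open and every client whose budget has reached `t` stops before paying for its
distance to `i`, or the offers to `i` at time `t` were covered by the opening cost of `i`. -/
def OfferHistory [Fintype C] (I : FLPInstance X F C) (i : F) (s : JMSState F C) : Prop :=
  ∀ t ≤ s.time, (i ∈ s.opened ∧ ∀ l, t ≤ s.budget l → s.budget l ≤ I.d i l) ∨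
    ∃ R : C → ℝ, (∑ j, (if s.budget j < t then R j else max (t - I.d i j) 0) ≤ I.openCost i) ∧
      ∀ j, s.budget j < t → 0 ≤ R j ∧ (s.budget j - I.d i j ≤ R j ∨
        ∃ i' ∈ s.opened, I.d i' j - I.d i j ≤ R j ∧ ∀ l, t ≤ s.budget l → s.budget l ≤ I.d i' l)

lemma offerHistory_init [Fintype C] (I : FLPInstance X F C) (i : F) :
    I.OfferHistory i (JMSState.init F C) := by
  intro t ht
  have ht : t ≤ 0 := ht
  refine Or.inr ⟨0, ?_, ?_⟩
  · refine le_trans (le_of_eq (Finset.sum_eq_zero fun j _ => ?_)) (I.openCost_nonneg i)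
    have := I.d_nonneg i j
    rw [if_neg (by simpa [JMSState.init] using ht)]
    exact max_eq_right (by linarith)
  · intro j hj
    simp only [JMSState.init] at hj
    linarith

variable [DecidableEq C]

lemma advance_zero (s : JMSState F C) : s.advance 0 = s := by
  cases s; simp [JMSState.advance]

lemma continuous_offer_advance (I : FLPInstance X F C) (s : JMSState F C) (i : F) (j : C) :
    Continuous fun ε : ℝ => I.offer (s.advance ε) i j := by
  unfold offer JMSState.advance
  cases h : s.conn j
  · simp only [h]
    by_cases hj : j ∈ s.active
    · simp only [hj, if_true]; fun_prop
    · simp only [hj, if_false]; fun_prop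
  · simp only [h]; fun_prop

variable [Fintype C] [DecidableEq F]

/-- Budgets and offers move continuously and start within their bounds, so exceeding a bound at `δ`
would mean meeting it, hence an event, strictly earlier. -/
lemma Inv.advance {I : FLPInstance X F C} {s : JMSState F C} (h : I.Inv s) {δ : ℝ} (hδ : 0 ≤ δ)
    (hne : ∀ ε : ℝ, 0 ≤ ε → ε < δ → ∀ s'', ¬ I.Event (s.advance ε) s'') :
    I.Inv (s.advance δ) where
  time_nonneg := add_nonneg h.time_nonneg hδ
  budget_active := fun j hj => by
    have hj : j ∈ s.active := hj
    simp [JMSState.advance, hj, h.budget_active j hj]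
  budget_le_time := fun j => by
    have := h.budget_le_time j
    simp only [JMSState.advance]
    split <;> linarith
  budget_le_penalty := fun j => by
    have h1 := h.budget_le_penalty j
    by_cases hj : j ∈ s.active
    · simp only [JMSState.advance, hj, if_true]
      by_contra! hlt
      refine hne (I.penalty j - s.budget j) (by linarith) (by linarith) _
        (Event.potentialRunsOut j hj ?_)
      simp [JMSState.advance, hj]
    · simpa [JMSState.advance, hj] using h1
  conn_active := h.conn_active
  conn_opened := h.conn_opened
  rejected := fun j hj hc => by
    have hj : j ∉ s.active := hj
    simpa [JMSState.advance, hj] using h.rejected j hj hc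
  le_dist := fun j hj i hi => by
    have hj : j ∈ s.active := hj
    have h1 := h.le_dist j hj i hi
    simp only [JMSState.advance, hj, if_true]
    by_contra! hlt
    refine hne (I.d i j - s.budget j) (by linarith) (by linarith) _
      (Event.clientConnects j i hj hi ?_)
    simp [JMSState.advance, hj]
  offers_le := fun i hi => by
    have hi : i ∉ s.opened := hi
    by_contra! hlt
    have hc : Continuous fun ε : ℝ => ∑ j, I.offer (s.advance ε) i j :=
      continuous_finsetSum _ fun j _ => I.continuous_offer_advance s i j
    have h0 : ∑ j, I.offer (s.advance 0) i j ≤ I.openCost i := by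
      rw [advance_zero]; exact h.offers_le i hi
    obtain ⟨ε, hε, he⟩ := intermediate_value_Icc hδ hc.continuousOn ⟨h0, hlt.le⟩
    refine hne ε hε.1 (lt_of_le_of_ne hε.2 ?_) _ (Event.facilityOpens i hi he)
    rintro rfl
    exact hlt.ne' he
  accounting := by
    refine h.accounting.trans (Finset.sum_congr rfl fun j _ => ?_)
    unfold connBudget
    cases hcj : s.conn j with
    | none => simp [JMSState.advance, hcj]
    | some i =>
      have hj : j ∉ s.active := fun hj => by simp [h.conn_active j hj] at hcj
      simp [JMSState.advance, hcj, hj]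

lemma event_cases {I : FLPInstance X F C} {s s' : JMSState F C} (he : I.Event s s') :
    s'.time = s.time ∧ s'.budget = s.budget ∧ s'.active ⊆ s.active ∧ s.opened ⊆ s'.opened := by
  cases he with
  | facilityOpens i hi ho => exact ⟨rfl, rfl, Finset.filter_subset _ _, Finset.subset_insert _ _⟩
  | clientConnects j i hj hi hd => exact ⟨rfl, rfl, Finset.erase_subset _ _, subset_rfl⟩
  | potentialRunsOut j hj hp => exact ⟨rfl, rfl, Finset.erase_subset _ _, subset_rfl⟩

lemma Inv.event {I : FLPInstance X F C} {s s' : JMSState F C} (h : I.Inv s) (he : I.Event s s') :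
    I.Inv s' := by
  obtain ⟨ht, hb, ha, ho⟩ := event_cases he
  have htime : 0 ≤ s'.time := ht ▸ h.time_nonneg
  have hact : ∀ j ∈ s'.active, s'.budget j = s'.time := fun j hj => by
    rw [hb, ht]; exact h.budget_active j (ha hj)
  have hlt : ∀ j, s'.budget j ≤ s'.time := fun j => by rw [hb, ht]; exact h.budget_le_time j
  have hpen : ∀ j, s'.budget j ≤ I.penalty j := fun j => by rw [hb]; exact h.budget_le_penalty j
  cases he with
  | facilityOpens i hi hoffer =>
    refine ⟨htime, hact, hlt, hpen, ?_, ?_, ?_, ?_, ?_, ?_⟩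
    · intro j hj
      simp only [openFacility, Finset.mem_filter] at hj ⊢
      rw [if_neg hj.2]
      exact h.conn_active j hj.1
    · intro j i' hc
      simp only [openFacility] at hc ⊢
      split_ifs at hc
      · simp_all
      · exact Finset.mem_insert_of_mem (h.conn_opened j i' hc)
    · intro j hj hc
      simp only [openFacility, Finset.mem_filter, not_and, not_not] at hj hc ⊢
      split_ifs at hc with h0
      exact h.rejected j (fun hja => h0 (hj hja)) hc
    · intro j hj i' hi'
      simp only [openFacility, Finset.mem_filter, Finset.mem_insert] at hj hi' ⊢
      rcases hi' with rfl | hi'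
      · have h1 := hj.2
        simp only [offer, h.conn_active j hj.1, lt_max_iff, lt_irrefl, or_false, not_lt] at h1
        linarith
      · exact h.le_dist j hj.1 i' hi'
    · intro i' hi'
      simp only [openFacility, Finset.mem_insert, not_or] at hi'
      -- Opening `i` never raises an offer to another facility: a client moves to `i` only if `i` is
      -- nearer than its old facility, or than its budget when it had none.
      refine le_trans (Finset.sum_le_sum fun j _ => ?_) (h.offers_le i' hi'.2)
      by_cases h0 : 0 < I.offer s i j
      · rw [offer_of_some (i' := i) (by simp [openFacility, h0])]
        cases hcj : s.conn j with
        | none =>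
          rw [offer_of_none hcj, lt_max_iff, or_iff_left (lt_irrefl _)] at h0
          rw [offer_of_none hcj]
          exact max_le_max (by linarith) le_rfl
        | some i'' =>
          rw [offer_of_some hcj, lt_max_iff, or_iff_left (lt_irrefl _)] at h0
          rw [offer_of_some hcj]
          exact max_le_max (by linarith) le_rfl
      · have hc : (I.openFacility s i).conn j = s.conn j := by simp [openFacility, h0]
        unfold offer
        rw [hc]
        exact le_rfl
    · have e1 : ∀ j, I.connCost (I.openFacility s i).conn j + I.offer s i j
          = I.connCost s.conn j + (connBudget (I.openFacility s i) j - connBudget s j) := by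
        intro j
        by_cases h0 : 0 < I.offer s i j
        · have hc : (I.openFacility s i).conn j = some i := by simp [openFacility, h0]
          unfold connCost connBudget
          rw [hc]
          cases hcj : s.conn j with
          | none =>
            rw [offer_of_none hcj] at h0 ⊢
            rw [lt_max_iff, or_iff_left (lt_irrefl _)] at h0
            rw [max_eq_left h0.le]
            simp only [openFacility]
            ring
          | some i'' =>
            rw [offer_of_some hcj] at h0 ⊢
            rw [lt_max_iff, or_iff_left (lt_irrefl _)] at h0
            rw [max_eq_left h0.le]
            simp only [openFacility]
            ring
        · have h1 : I.offer s i j = 0 := le_antisymm (not_lt.1 h0) (I.offer_nonneg s i j)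
          have hc : (I.openFacility s i).conn j = s.conn j := by simp [openFacility, h0]
          unfold connCost connBudget
          rw [hc, h1]
          simp only [openFacility]
          ring
      have e2 := Finset.sum_congr (rfl : (Finset.univ : Finset C) = Finset.univ) fun j _ => e1 j
      simp only [Finset.sum_add_distrib, Finset.sum_sub_distrib, hoffer] at e2
      have e3 := h.accounting
      change ∑ i ∈ insert i s.opened, I.openCost i + _ = _
      rw [Finset.sum_insert hi]
      linarith
  | clientConnects j i hj hi hd =>
    have hcj := h.conn_active j hj
    refine ⟨htime, hact, hlt, hpen, ?_, ?_, ?_, ?_, ?_, ?_⟩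
    · intro l hl
      simp only [Finset.mem_erase] at hl ⊢
      rw [Function.update_of_ne hl.1]
      exact h.conn_active l hl.2
    · intro l i' hc
      by_cases hl : l = j
      · subst hl; simp at hc; exact hc ▸ hi
      · simp only [Function.update_of_ne hl] at hc
        exact h.conn_opened l i' hc
    · intro l hl hc
      by_cases hlj : l = j
      · subst hlj; simp at hc
      · simp only [Function.update_of_ne hlj] at hc
        simp only [Finset.mem_erase, not_and] at hl
        exact h.rejected l (hl hlj) hc
    · intro l hl i' hi'
      exact h.le_dist l (Finset.mem_of_mem_erase hl) i' hi'
    · intro i' hi'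
      refine le_trans (Finset.sum_le_sum fun l _ => ?_) (h.offers_le i' hi')
      -- At the moment of connection the budget equals the new distance, so the offers of `j` do not
      -- jump.
      by_cases hlj : l = j
      · subst hlj; simp [offer, hcj, hd]
      · simp [offer, Function.update_of_ne hlj]
    · have e1 : ∀ l, I.connCost (Function.update s.conn j (some i)) l - I.connCost s.conn l
          = connBudget { s with active := s.active.erase j
                                conn := Function.update s.conn j (some i) } l
            - connBudget s l := by
        intro l
        by_cases hlj : l = j
        · subst hlj; simp [connCost, connBudget, hcj, hd]
        · simp [connCost, connBudget, Function.update_of_ne hlj]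
      have e2 := Finset.sum_congr (rfl : (Finset.univ : Finset C) = Finset.univ) fun j _ => e1 j
      simp only [Finset.sum_sub_distrib] at e2
      have e3 := h.accounting
      simp only at e2 ⊢
      linarith
  | potentialRunsOut j hj hp =>
    refine ⟨htime, hact, hlt, hpen, ?_, h.conn_opened, ?_, ?_, h.offers_le, h.accounting⟩
    · exact fun l hl => h.conn_active l (Finset.mem_of_mem_erase hl)
    · intro l hl hc
      by_cases hlj : l = j
      · subst hlj; exact hp
      · simp only [Finset.mem_erase, not_and] at hl
        exact h.rejected l (hl hlj) hc
    · exact fun l hl i' hi' => h.le_dist l (Finset.mem_of_mem_erase hl) i' hi'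

lemma Inv.of_reaches {I : FLPInstance X F C} {n : ℕ} {s : JMSState F C} (h : I.Reaches n s) :
    I.Inv s := by
  induction h with
  | init => exact I.inv_init
  | step _ hs ih =>
    obtain ⟨_, δ, hδ, hne, he⟩ := hs
    exact (ih.advance hδ hne).event he

lemma exists_event_iff {I : FLPInstance X F C} {s : JMSState F C} :
    (∃ s', I.Event s s') ↔ (∃ i, i ∉ s.opened ∧ ∑ j, I.offer s i j = I.openCost i) ∨
      (∃ j ∈ s.active, ∃ i ∈ s.opened, s.budget j = I.d i j) ∨
      ∃ j ∈ s.active, s.budget j = I.penalty j := by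
  constructor
  · rintro ⟨s', he⟩
    cases he with
    | facilityOpens i hi ho => exact Or.inl ⟨i, hi, ho⟩
    | clientConnects j i hj hi hd => exact Or.inr (Or.inl ⟨j, hj, i, hi, hd⟩)
    | potentialRunsOut j hj hp => exact Or.inr (Or.inr ⟨j, hj, hp⟩)
  · rintro (⟨i, hi, ho⟩ | ⟨j, hj, i, hi, hd⟩ | ⟨j, hj, hp⟩)
    · exact ⟨_, Event.facilityOpens i hi ho⟩
    · exact ⟨_, Event.clientConnects j i hj hi hd⟩
    · exact ⟨_, Event.potentialRunsOut j hj hp⟩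

/-- A finite union of level sets of continuous functions. Closedness makes the first event time a
minimum rather than a mere infimum. -/
lemma isClosed_event_times [Fintype F] (I : FLPInstance X F C) (s : JMSState F C) :
    IsClosed {δ : ℝ | ∃ s', I.Event (s.advance δ) s'} := by
  have hE : {δ : ℝ | ∃ s', I.Event (s.advance δ) s'} =
      (⋃ i : {i // i ∉ s.opened}, {δ : ℝ | ∑ j, I.offer (s.advance δ) i j = I.openCost i}) ∪
      ((⋃ j : s.active, ⋃ i : s.opened, {δ : ℝ | (s.advance δ).budget j = I.d i j}) ∪
        ⋃ j : s.active, {δ : ℝ | (s.advance δ).budget j = I.penalty j}) := by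
    ext δ
    have ho : (s.advance δ).opened = s.opened := rfl
    have ha : (s.advance δ).active = s.active := rfl
    simp [exists_event_iff, ho, ha]
  rw [hE]
  have hb : ∀ j, Continuous fun δ : ℝ => (s.advance δ).budget j := fun j => by
    unfold JMSState.advance
    by_cases hj : j ∈ s.active
    · simp only [hj, if_true]; fun_prop
    · simp only [hj, if_false]; fun_prop
  refine IsClosed.union (isClosed_iUnion_of_finite fun i => ?_) (IsClosed.union
    (isClosed_iUnion_of_finite fun j => isClosed_iUnion_of_finite fun i => ?_)
    (isClosed_iUnion_of_finite fun j => ?_))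
  · exact isClosed_eq (continuous_finsetSum _ fun j _ => I.continuous_offer_advance s i j)
      continuous_const
  · exact isClosed_eq (hb j) continuous_const
  · exact isClosed_eq (hb j) continuous_const

/-- Some event must come, because any active client eventually exhausts its penalty. -/
lemma Inv.exists_step [Fintype F] {I : FLPInstance X F C} {s : JMSState F C} (h : I.Inv s)
    (hs : s.active.Nonempty) : ∃ s', I.Step s s' := by
  obtain ⟨j, hj⟩ := hs
  set E : Set ℝ := {δ : ℝ | ∃ s', I.Event (s.advance δ) s'} ∩ Set.Ici 0 with hE
  have hcl : IsClosed E := (I.isClosed_event_times s).inter isClosed_Ici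
  have hne : E.Nonempty := by
    refine ⟨I.penalty j - s.budget j, ⟨_, Event.potentialRunsOut j hj ?_⟩,
      sub_nonneg.2 (h.budget_le_penalty j)⟩
    simp [JMSState.advance, hj]
  have hbd : BddBelow E := ⟨0, fun x hx => hx.2⟩
  obtain ⟨⟨s', he⟩, h0⟩ := hcl.csInf_mem hne hbd
  exact ⟨s', ⟨j, hj⟩, sInf E, h0, fun ε h1 h2 s'' he' =>
    not_lt.2 (csInf_le hbd ⟨⟨s'', he'⟩, h1⟩) h2, he⟩

/-- Every iteration opens a facility or retires a client. It is only an inequality because an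
opening may retire clients as well. -/
lemma reaches_card {I : FLPInstance X F C} {n : ℕ} {s : JMSState F C} (h : I.Reaches n s) :
    n + s.active.card ≤ s.opened.card + Fintype.card C := by
  induction h with
  | init => simp [JMSState.init]
  | @step n s s' _ hs ih =>
    obtain ⟨_, δ, _, _, he⟩ := hs
    cases he with
    | facilityOpens i hi ho =>
      have hi : i ∉ s.opened := hi
      have h1 : (I.openFacility (s.advance δ) i).opened.card = s.opened.card + 1 :=
        Finset.card_insert_of_notMem hi
      have h2 : (I.openFacility (s.advance δ) i).active.card ≤ s.active.card :=
        Finset.card_le_card (Finset.filter_subset _ _)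
      omega
    | clientConnects j i hj hi hd =>
      have hj : j ∈ s.active := hj
      have h1 := Finset.card_erase_add_one hj
      simp only [JMSState.advance]
      omega
    | potentialRunsOut j hj hp =>
      have hj : j ∈ s.active := hj
      have h1 := Finset.card_erase_add_one hj
      simp only [JMSState.advance]
      omega

/-- Past times keep their record, since the budgets below `t` are already frozen. A new time is
recorded by means of the actual offers at that moment. -/
lemma OfferHistory.advance {I : FLPInstance X F C} {i : F} {s : JMSState F C}
    (hh : I.OfferHistory i s) (h : I.Inv s) {δ : ℝ} (hδ : 0 ≤ δ)
    (hne : ∀ ε : ℝ, 0 ≤ ε → ε < δ → ∀ s'', ¬ I.Event (s.advance ε) s'') :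
    I.OfferHistory i (s.advance δ) := by
  have h' := h.advance hδ hne
  intro t ht
  by_cases hts : t ≤ s.time
  · have hle : ∀ j, t ≤ (s.advance δ).budget j ↔ t ≤ s.budget j := fun j => by
      simp only [JMSState.advance]
      split_ifs with hj
      · have := h.budget_active j hj
        constructor <;> intro <;> linarith
      · rfl
    have hlt : ∀ j, (s.advance δ).budget j < t ↔ s.budget j < t := fun j => by
      rw [← not_le, hle, not_le]
    have heq : ∀ j, s.budget j < t → (s.advance δ).budget j = s.budget j := fun j hj => by
      have : j ∉ s.active := fun hja => by
        have := h.budget_active j hja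
        linarith
      simp [JMSState.advance, this]
    -- Active clients still grow, but never beyond their distance to an open facility.
    have hd : ∀ i' ∈ s.opened, (∀ l, t ≤ s.budget l → s.budget l ≤ I.d i' l) →
        ∀ l, t ≤ (s.advance δ).budget l → (s.advance δ).budget l ≤ I.d i' l := by
      intro i' hi' hl l htl
      by_cases hla : l ∈ s.active
      · exact h'.le_dist l hla i' hi'
      · have := hl l ((hle l).1 htl)
        simpa [JMSState.advance, hla] using this
    rcases hh t hts with ⟨hi, hl⟩ | ⟨R, hR, hRj⟩
    · exact Or.inl ⟨hi, hd i hi hl⟩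
    · refine Or.inr ⟨R, by simpa only [hlt] using hR, fun j hj => ?_⟩
      have hj' := (hlt j).1 hj
      obtain ⟨h0, h1⟩ := hRj j hj'
      refine ⟨h0, ?_⟩
      rw [heq j hj']
      rcases h1 with h1 | ⟨i', hi', h1, h2⟩
      · exact Or.inl h1
      · exact Or.inr ⟨i', hi', h1, hd i' hi' h2⟩
  · push Not at hts
    have ht : t ≤ s.time + δ := ht
    have hact : ∀ j, t ≤ (s.advance δ).budget j ↔ j ∈ s.active := fun j => by
      simp only [JMSState.advance]
      split_ifs with hj
      · have := h.budget_active j hj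
        simp only [hj, iff_true]
        linarith
      · have := h.budget_le_time j
        simp only [hj, iff_false]
        linarith
    have hopen : ∀ i' ∈ s.opened,
        ∀ l, t ≤ (s.advance δ).budget l → (s.advance δ).budget l ≤ I.d i' l :=
      fun i' hi' l hl => h'.le_dist l ((hact l).1 hl) i' hi'
    by_cases hi : i ∈ s.opened
    · exact Or.inl ⟨hi, hopen i hi⟩
    · have h'' : I.Inv (s.advance (t - s.time)) :=
        h.advance (by linarith) fun ε h1 h2 => hne ε h1 (by linarith)
      -- No event has occurred before `t`, so the invariant at time `t` bounds the offers to the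
      -- closed facility `i` by its cost.
      refine Or.inr ⟨fun j => I.offer (s.advance (t - s.time)) i j, ?_, ?_⟩
      · refine le_trans (Finset.sum_le_sum fun j _ => ?_) (h''.offers_le i hi)
        split_ifs with hj
        · exact le_rfl
        · have hja := (hact j).1 (not_lt.1 hj)
          have hc : (s.advance (t - s.time)).conn j = none := h.conn_active j hja
          have hb := h''.budget_active j hja
          simp only [offer, hc, hb]
          simp [JMSState.advance]
      · intro j hj
        have hja : j ∉ s.active := fun hja => not_le.2 hj ((hact j).2 hja)
        refine ⟨I.offer_nonneg _ _ _, ?_⟩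
        cases hcj : s.conn j with
        | none =>
          left
          have hc : (s.advance (t - s.time)).conn j = none := hcj
          simp only [offer, hc]
          simp [JMSState.advance, hja]
        | some i' =>
          right
          have hc : (s.advance (t - s.time)).conn j = some i' := hcj
          refine ⟨i', h.conn_opened j i' hcj, ?_, hopen i' (h.conn_opened j i' hcj)⟩
          simp only [offer, hc]
          exact le_max_left _ _

lemma OfferHistory.event {I : FLPInstance X F C} {i : F} {s s' : JMSState F C}
    (hh : I.OfferHistory i s) (he : I.Event s s') : I.OfferHistory i s' := by
  obtain ⟨ht, hb, _, ho⟩ := event_cases he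
  intro t hts
  rw [ht] at hts
  rw [hb]
  rcases hh t hts with ⟨hi, hl⟩ | ⟨R, hR, hRj⟩
  · exact Or.inl ⟨ho hi, hl⟩
  · refine Or.inr ⟨R, hR, fun j hj => ?_⟩
    obtain ⟨h0, h1⟩ := hRj j hj
    refine ⟨h0, h1.imp_right ?_⟩
    rintro ⟨i', hi', h2⟩
    exact ⟨i', ho hi', h2⟩

lemma OfferHistory.of_reaches {I : FLPInstance X F C} {n : ℕ} {s : JMSState F C}
    (h : I.Reaches n s) (i : F) : I.OfferHistory i s := by
  induction h with
  | init => exact I.offerHistory_init i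
  | step hr hs ih =>
    obtain ⟨_, δ, hδ, hne, he⟩ := hs
    exact (ih.advance (Inv.of_reaches hr) hδ hne).event he

end Algorithm

end FLPInstance

/-! ### Weak duality for the continuous factor-revealing program -/

section Continuum

open MeasureTheory Set intervalIntegral

/-- Measurable functions that are bounded on bounded sets. -/
structure LocBddMeasurable (u : ℝ → ℝ) : Prop where
  measurable : Measurable u
  bounded : ∀ R : ℝ, ∃ C : ℝ, ∀ x, |x| ≤ R → |u x| ≤ C

namespace LocBddMeasurable

lemma of_continuous {u : ℝ → ℝ} (hu : Continuous u) : LocBddMeasurable u := by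
  refine ⟨hu.measurable, fun R => ?_⟩
  obtain ⟨C, hC⟩ := (isCompact_Icc (a := -R) (b := R)).exists_bound_of_continuousOn hu.continuousOn
  exact ⟨C, fun x hx => hC x (abs_le.1 hx)⟩

lemma const (c : ℝ) : LocBddMeasurable fun _ => c := of_continuous continuous_const

lemma add {u v : ℝ → ℝ} (hu : LocBddMeasurable u) (hv : LocBddMeasurable v) :
    LocBddMeasurable fun x => u x + v x := by
  refine ⟨hu.1.add hv.1, fun R => ?_⟩
  obtain ⟨C, hC⟩ := hu.2 R
  obtain ⟨D, hD⟩ := hv.2 R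
  exact ⟨C + D, fun x hx => (abs_add_le _ _).trans (add_le_add (hC x hx) (hD x hx))⟩

lemma mul {u v : ℝ → ℝ} (hu : LocBddMeasurable u) (hv : LocBddMeasurable v) :
    LocBddMeasurable fun x => u x * v x := by
  refine ⟨hu.1.mul hv.1, fun R => ?_⟩
  obtain ⟨C, hC⟩ := hu.2 R
  obtain ⟨D, hD⟩ := hv.2 R
  refine ⟨C * D, fun x hx => ?_⟩
  rw [abs_mul]
  exact mul_le_mul (hC x hx) (hD x hx) (abs_nonneg _) ((abs_nonneg _).trans (hC x hx))

lemma sub {u v : ℝ → ℝ} (hu : LocBddMeasurable u) (hv : LocBddMeasurable v) :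
    LocBddMeasurable fun x => u x - v x := by
  simpa [sub_eq_add_neg] using hu.add ((const (-1)).mul hv)

lemma ite_le {u v : ℝ → ℝ} (a : ℝ) (hu : LocBddMeasurable u) (hv : LocBddMeasurable v) :
    LocBddMeasurable fun x => if x ≤ a then u x else v x := by
  refine ⟨Measurable.ite measurableSet_Iic hu.1 hv.1, fun R => ?_⟩
  obtain ⟨C, hC⟩ := hu.2 R
  obtain ⟨D, hD⟩ := hv.2 R
  refine ⟨max C D, fun x hx => ?_⟩
  split_ifs
  · exact (hC x hx).trans (le_max_left _ _)
  · exact (hD x hx).trans (le_max_right _ _)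

lemma comp_finite {ι : Type*} [Finite ι] [MeasurableSpace ι] [MeasurableSingletonClass ι]
    {φ : ℝ → ι} (hφ : Measurable φ) (g : ι → ℝ) : LocBddMeasurable fun x => g (φ x) := by
  refine ⟨(measurable_of_finite g).comp hφ, fun R => ?_⟩
  obtain ⟨C, hC⟩ := (Set.finite_range fun i => |g i|).bddAbove
  exact ⟨C, fun x _ => hC ⟨φ x, rfl⟩⟩

lemma intervalIntegrable {u : ℝ → ℝ} (hu : LocBddMeasurable u) (a b : ℝ) :
    IntervalIntegrable u volume a b := by
  obtain ⟨C, hC⟩ := hu.2 (max |a| |b|)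
  rw [intervalIntegrable_iff]
  refine Measure.integrableOn_of_bounded (M := C) (by simp) hu.1.aestronglyMeasurable ?_
  refine (ae_restrict_iff' measurableSet_uIoc).2 (Filter.Eventually.of_forall fun x hx => ?_)
  refine hC x (abs_le_max_abs_abs (uIoc_subset_uIcc hx).1 (uIoc_subset_uIcc hx).2 |>.trans ?_)
  rcases le_total a b with h | h <;> simp [h, max_comm]

lemma primitive {u : ℝ → ℝ} (hu : LocBddMeasurable u) :
    LocBddMeasurable fun x => ∫ y in (0 : ℝ)..x, u y :=
  of_continuous (continuous_primitive hu.intervalIntegrable 0)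

lemma primitive_left {u : ℝ → ℝ} (hu : LocBddMeasurable u) :
    LocBddMeasurable fun x => ∫ y in x..(1 : ℝ), u y := by
  have : (fun x => ∫ y in x..(1 : ℝ), u y) =
      fun x => (∫ y in (0 : ℝ)..1, u y) - ∫ y in (0 : ℝ)..x, u y := by
    funext x
    rw [integral_interval_sub_left (hu.intervalIntegrable _ _) (hu.intervalIntegrable _ _)]
  rw [this]
  exact (const _).sub hu.primitive

end LocBddMeasurable

lemma integral_zero_one_ite_le {u : ℝ → ℝ} (hu : LocBddMeasurable u) {a : ℝ} (ha : 0 ≤ a)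
    (ha' : a ≤ 1) :
    ∫ x in (0 : ℝ)..1, (if x ≤ a then u x else 0) = ∫ x in (0 : ℝ)..a, u x := by
  have hI := (hu.ite_le a (LocBddMeasurable.const 0)).intervalIntegrable
  rw [← integral_add_adjacent_intervals (hI 0 a) (hI a 1),
    integral_congr_Ioo_of_le (g := u) ha fun x hx => if_pos hx.2.le,
    integral_congr_Ioo_of_le (g := fun _ => 0) ha' fun x hx => if_neg (not_le.2 hx.1)]
  simp

lemma integral_zero_one_ite_gt {u : ℝ → ℝ} (hu : LocBddMeasurable u) {a : ℝ} (ha : 0 ≤ a)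
    (ha' : a ≤ 1) :
    ∫ x in (0 : ℝ)..1, (if x ≤ a then 0 else u x) = ∫ x in a..(1 : ℝ), u x := by
  have hI := ((LocBddMeasurable.const 0).ite_le a hu).intervalIntegrable
  rw [← integral_add_adjacent_intervals (hI 0 a) (hI a 1),
    integral_congr_Ioo_of_le (g := fun _ => 0) ha fun x hx => if_pos hx.2.le,
    integral_congr_Ioo_of_le (g := u) ha' fun x hx => if_neg (not_le.2 hx.1)]
  simp

/-- Fubini's theorem for the triangle below the diagonal of the unit square. -/
lemma integral_mul_primitive {u v : ℝ → ℝ} (hu : LocBddMeasurable u) (hv : LocBddMeasurable v) :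
    ∫ x in (0 : ℝ)..1, u x * (∫ y in (0 : ℝ)..x, v y) =
      ∫ y in (0 : ℝ)..1, v y * (∫ x in y..(1 : ℝ), u x) := by
  have h1 : ∀ x ∈ Ioo (0 : ℝ) 1, u x * (∫ y in (0 : ℝ)..x, v y) =
      ∫ y in (0 : ℝ)..1, (if y ≤ x then u x * v y else 0) := fun x hx => by
    rw [integral_zero_one_ite_le ((LocBddMeasurable.const _).mul hv) hx.1.le hx.2.le,
      intervalIntegral.integral_const_mul]
  have h2 : ∀ y ∈ Ioo (0 : ℝ) 1, v y * (∫ x in y..(1 : ℝ), u x) =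
      ∫ x in (0 : ℝ)..1, (if y ≤ x then u x * v y else 0) := fun y hy => by
    have h3 : ∫ x in (0 : ℝ)..1, (if y ≤ x then u x * v y else 0) =
        ∫ x in (0 : ℝ)..1, (if x ≤ y then 0 else v y * u x) := by
      refine integral_congr_ae ?_
      -- The two indicators disagree only on the diagonal.
      have : ∀ᵐ x : ℝ, x ≠ y := by simp [ae_iff]
      filter_upwards [this] with x hx _
      rcases lt_or_gt_of_ne hx with h | h
      · simp [h.le, not_le.2 h]
      · simp [h.le, not_le.2 h, mul_comm]
    rw [h3, integral_zero_one_ite_gt ((LocBddMeasurable.const _).mul hu) hy.1.le hy.2.le,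
      intervalIntegral.integral_const_mul]
  rw [integral_congr_Ioo_of_le zero_le_one h1, integral_congr_Ioo_of_le zero_le_one h2]
  simp only [integral_of_le zero_le_one]
  refine integral_integral_swap ?_
  obtain ⟨C, hC⟩ := hu.2 1
  obtain ⟨D, hD⟩ := hv.2 1
  have hm : Measurable (Function.uncurry fun x y : ℝ => if y ≤ x then u x * v y else 0) :=
    Measurable.ite (measurableSet_le measurable_snd measurable_fst)
      ((hu.1.comp measurable_fst).mul (hv.1.comp measurable_snd)) measurable_const
  have hC0 : 0 ≤ C := (abs_nonneg _).trans (hC 0 (by simp))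
  refine Integrable.of_bound hm.aestronglyMeasurable (C * D) ?_
  rw [Measure.prod_restrict]
  refine (ae_restrict_iff' (measurableSet_Ioc.prod measurableSet_Ioc)).2
    (Filter.Eventually.of_forall fun p hp => ?_)
  have h1 : |u p.1| ≤ C := hC _ (abs_le.2 ⟨by linarith [hp.1.1], hp.1.2⟩)
  have h2 : |v p.2| ≤ D := hD _ (abs_le.2 ⟨by linarith [hp.2.1], hp.2.2⟩)
  have hD0 : 0 ≤ D := (abs_nonneg _).trans h2
  simp only [Function.uncurry, Real.norm_eq_abs]
  split_ifs
  · rw [abs_mul]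
    exact mul_le_mul h1 h2 (abs_nonneg _) hC0
  · simpa using mul_nonneg hC0 hD0

/-- A dual solution of the continuous factor-revealing program, which certifies the bifactor
`(γf, γc)`. The constraint at position `x` is taken with weight `θ x`; it uses the share `s y` of
the earlier client at `y`, and the later clients, those beyond `b` being left out if `x ≤ a`. The
triangle inequality of the client at `x` gets the weight `ν x`. -/
structure DualCertificate (γf γc a b c : ℝ) (θ s ν P : ℝ → ℝ) : Prop where
  a_pos : 0 < a
  a_le : a ≤ c
  c_le : c ≤ b
  b_lt : b < 1
  θ_meas : LocBddMeasurable θ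
  s_meas : LocBddMeasurable s
  ν_meas : LocBddMeasurable ν
  θ_nonneg : ∀ x ∈ Ioc (0 : ℝ) 1, 0 ≤ θ x
  θ_eq_zero : ∀ x ∈ Ioc b 1, θ x = 0
  s_nonneg : ∀ x ∈ Ioc (0 : ℝ) 1, 0 ≤ s x
  s_le_one : ∀ x ∈ Ioc (0 : ℝ) 1, s x ≤ 1
  s_eq_zero : ∀ x ∈ Ioc c 1, s x = 0
  ν_nonneg : ∀ x ∈ Ioc (0 : ℝ) 1, 0 ≤ ν x
  primitive : ∀ y ∈ Icc (0 : ℝ) 1, ∫ x in (0 : ℝ)..y, θ x = P y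
  total : P 1 = γf
  budget_early : ∀ x ∈ Ioc 0 a, 1 ≤ θ x * (b - x) + ν x
  budget_late : ∀ x ∈ Ioc a 1, 1 ≤ θ x * (1 - x) + ν x
  dist_early : ∀ x ∈ Ioc 0 b, 2 * (s x * (γf - P x)) + P x + ν x ≤ γc
  dist_late : ∀ x ∈ Ioc b 1, P x - P a + ν x ≤ γc
  triangle : ∀ x ∈ Ioc 0 c, ν x ≤ θ x * ∫ y in (0 : ℝ)..x, s y
  balance : ∫ x in (0 : ℝ)..1, ν x ≤ ∫ x in (0 : ℝ)..1, s x * (γf - P x)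
  balance_late : (γf - P c) * c ≤ ∫ x in b..(1 : ℝ), ν x

/-- Weak duality for the continuous factor-revealing program. -/
theorem DualCertificate.integral_le {γf γc a b c : ℝ} {θ s ν P : ℝ → ℝ}
    (h : DualCertificate γf γc a b c θ s ν P) {α d m : ℝ → ℝ} {f : ℝ}
    (hα : LocBddMeasurable α) (hd : LocBddMeasurable d)
    (hα0 : ∀ x ∈ Ioc (0 : ℝ) 1, 0 ≤ α x) (hd0 : ∀ x ∈ Ioc (0 : ℝ) 1, 0 ≤ d x)
    (hm0 : ∀ x ∈ Ioc (0 : ℝ) 1, 0 ≤ m x) (hmanti : AntitoneOn m (Ioc 0 1))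
    (hβ : ∀ x ∈ Ioc (0 : ℝ) 1, α x - d x ≤ m x)
    (hf : ∀ x ∈ Ioc (0 : ℝ) 1, ∀ l ∈ Icc x 1,
      (∫ y in (0 : ℝ)..x, s y * (m x - 2 * d y)) + ∫ y in x..l, (α x - d y) ≤ f) :
    ∫ x in (0 : ℝ)..1, α x ≤ γf * f + γc * ∫ x in (0 : ℝ)..1, d x := by
  obtain ⟨a0, ac, cb, b1⟩ := And.intro h.a_pos (And.intro h.a_le (And.intro h.c_le h.b_lt))
  have hθ := h.θ_meas
  have hs := h.s_meas
  have hν := h.ν_meas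
  have hsd : LocBddMeasurable fun y => s y * d y := hs.mul hd
  set S : ℝ → ℝ := fun x => ∫ y in (0 : ℝ)..x, s y with hSdef
  set D : ℝ → ℝ := fun x => ∫ y in (0 : ℝ)..x, s y * d y with hDdef
  set E : ℝ → ℝ := fun x => ∫ y in x..(1 : ℝ), d y with hEdef
  have hS : LocBddMeasurable S := hs.primitive
  have hD : LocBddMeasurable D := hsd.primitive
  have hE : LocBddMeasurable E := hd.primitive_left
  have hc1 : c ∈ Ioc (0 : ℝ) 1 := ⟨by linarith, by linarith⟩
  have hb1 : b ∈ Ioc (0 : ℝ) 1 := ⟨by linarith, by linarith⟩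
  have hPr : LocBddMeasurable fun x => ∫ y in (0 : ℝ)..x, θ y := hθ.primitive
  have htail : ∀ y ∈ Icc (0 : ℝ) 1, ∫ x in y..(1 : ℝ), θ x = γf - P y := fun y hy => by
    rw [← h.total, ← h.primitive 1 (by simp), ← h.primitive y hy,
      integral_interval_sub_left (hθ.intervalIntegrable _ _) (hθ.intervalIntegrable _ _)]
  have hSc : ∀ x ∈ Ioc c 1, S x ≤ c := fun x hx => by
    have e1 : S x = (∫ y in (0 : ℝ)..c, s y) + ∫ y in c..x, s y :=
      (integral_add_adjacent_intervals (hs.intervalIntegrable _ _)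
        (hs.intervalIntegrable _ _)).symm
    have e2 : ∫ y in c..x, s y = ∫ y in c..x, (0 : ℝ) :=
      integral_congr_Ioo_of_le hx.1.le fun y hy => h.s_eq_zero y ⟨hy.1, by linarith [hy.2, hx.2]⟩
    have e3 : ∫ y in (0 : ℝ)..c, s y ≤ ∫ y in (0 : ℝ)..c, (1 : ℝ) :=
      integral_mono_on_of_le_Ioo hc1.1.le (hs.intervalIntegrable _ _)
        ((LocBddMeasurable.const 1).intervalIntegrable _ _)
        fun y hy => h.s_le_one y ⟨hy.1, by linarith [hy.2]⟩
    simp at e2 e3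
    linarith
  have hS0 : ∀ x ∈ Ioc c 1, 0 ≤ S x := fun x hx => by
    have e1 : ∫ y in (0 : ℝ)..x, (0 : ℝ) ≤ S x :=
      integral_mono_on_of_le_Ioo (by linarith [hx.1]) ((LocBddMeasurable.const 0).intervalIntegrable _ _)
        (hs.intervalIntegrable _ _) fun y hy => h.s_nonneg y ⟨hy.1, by linarith [hy.2, hx.2]⟩
    simpa using e1
  have hcb : m b ≤ m c := hmanti hc1 hb1 cb
  -- The combination of the constraints before integration: `θ x` times the offer constraint, with
  -- `l = b` if `x ≤ a` and `l = 1` otherwise, plus `ν x` times `α x - d x ≤ m x`. The unknown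
  -- function `m` survives only through its values at `c` and `b`.
  have hpt : ∀ x ∈ Ioo (0 : ℝ) 1,
      α x - ν x * d x - 2 * (θ x * D x) - θ x * E x + E b * (if x ≤ a then θ x else 0)
        + m c * ((if x ≤ c then θ x * S x else 0) - (if x ≤ b then ν x else 0))
        + m b * ((if x ≤ c then 0 else θ x * S x) - (if x ≤ b then 0 else ν x)) ≤ f * θ x := by
    intro x hx
    have hx' : x ∈ Ioc (0 : ℝ) 1 := ⟨hx.1, hx.2.le⟩
    have e1 : ∫ y in (0 : ℝ)..x, s y * (m x - 2 * d y) = m x * S x - 2 * D x := by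
      have : ∀ y, s y * (m x - 2 * d y) = m x * s y - 2 * (s y * d y) := fun y => by ring
      simp only [this]
      rw [intervalIntegral.integral_sub
        (((LocBddMeasurable.const _).mul hs).intervalIntegrable _ _)
        (((LocBddMeasurable.const _).mul hsd).intervalIntegrable _ _),
        intervalIntegral.integral_const_mul, intervalIntegral.integral_const_mul]
    have e2 : ∀ l, ∫ y in x..l, (α x - d y) = α x * (l - x) - (E x - E l) := fun l => by
      rw [intervalIntegral.integral_sub ((LocBddMeasurable.const _).intervalIntegrable _ _)
        (hd.intervalIntegrable _ _), intervalIntegral.integral_const, smul_eq_mul, mul_comm]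
      congr 1
      rw [hEdef, eq_sub_iff_add_eq]
      exact integral_add_adjacent_intervals (hd.intervalIntegrable _ _)
        (hd.intervalIntegrable _ _)
    have hE1 : E 1 = 0 := by simp [hEdef]
    have hθx := h.θ_nonneg x hx'
    have hνx := h.ν_nonneg x hx'
    have hαx := hα0 x hx'
    have hνβ : ν x * (α x - d x) ≤ ν x * m x := mul_le_mul_of_nonneg_left (hβ x hx') hνx
    have hconn : (1 - ν x) * α x - θ x * E x + E b * (if x ≤ a then θ x else 0)
        + θ x * (m x * S x - 2 * D x) ≤ f * θ x := by
      by_cases hxa : x ≤ a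
      · have h1 := hf x hx' b ⟨by linarith, b1.le⟩
        rw [e1, e2] at h1
        have h2 := mul_le_mul_of_nonneg_left h1 hθx
        have h3 := mul_le_mul_of_nonneg_right (h.budget_early x ⟨hx.1, hxa⟩) hαx
        simp only [hxa, if_true]
        nlinarith
      · have h1 := hf x hx' 1 ⟨hx.2.le, le_rfl⟩
        rw [e1, e2, hE1] at h1
        have h2 := mul_le_mul_of_nonneg_left h1 hθx
        have h3 := mul_le_mul_of_nonneg_right
          (h.budget_late x ⟨not_le.1 hxa, hx.2.le⟩) hαx
        simp only [hxa, if_false]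
        nlinarith
    -- Monotonicity of `m`, applied by sign. Up to `c` the net coefficient `θ S - ν` is nonnegative,
    -- so `m` drops to `m c`. Between `c` and `b` the positive part drops to `m b` while the
    -- negative part rises to `m c`. Beyond `b` only `ν` is left, and there `m` is at most `m b`.
    have htri : m c * ((if x ≤ c then θ x * S x else 0) - (if x ≤ b then ν x else 0))
        + m b * ((if x ≤ c then 0 else θ x * S x) - (if x ≤ b then 0 else ν x))
        ≤ θ x * S x * m x - ν x * m x := by
      by_cases hxc : x ≤ c
      · have hxb : x ≤ b := hxc.trans cb
        have h1 := h.triangle x ⟨hx.1, hxc⟩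
        have h2 := mul_le_mul_of_nonneg_left (hmanti hx' hc1 hxc) (sub_nonneg.2 h1)
        simp only [hxc, hxb, if_true]
        linarith
      · have hxc' := not_le.1 hxc
        have h1 := hmanti hc1 hx' hxc'.le
        have h2 := mul_le_mul_of_nonneg_left h1 hνx
        by_cases hxb : x ≤ b
        · have h3 := hmanti hx' hb1 hxb
          have h4 := mul_le_mul_of_nonneg_left h3
            (mul_nonneg hθx (hS0 x ⟨hxc', hx.2.le⟩))
          simp only [hxc, hxb, if_true, if_false]
          linarith
        · have h3 := hmanti hb1 hx' (not_le.1 hxb).le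
          have h4 := mul_le_mul_of_nonneg_left h3 hνx
          simp only [hxc, hxb, if_false, h.θ_eq_zero x ⟨not_le.1 hxb, hx.2.le⟩]
          linarith
    linarith
  have hz := LocBddMeasurable.const 0
  have hθS := hθ.mul hS
  have i1 := hα.intervalIntegrable 0 1
  have i2 := (hν.mul hd).intervalIntegrable 0 1
  have i3 := ((LocBddMeasurable.const 2).mul (hθ.mul hD)).intervalIntegrable 0 1
  have i4 := (hθ.mul hE).intervalIntegrable 0 1
  have i5 := ((LocBddMeasurable.const (E b)).mul (hθ.ite_le a hz)).intervalIntegrable 0 1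
  have i6 := (hθS.ite_le c hz).intervalIntegrable 0 1
  have i7 := (hν.ite_le b hz).intervalIntegrable 0 1
  have i8 := (hz.ite_le c hθS).intervalIntegrable 0 1
  have i9 := (hz.ite_le b hν).intervalIntegrable 0 1
  have hint := integral_mono_on_of_le_Ioo zero_le_one
    ((((((i1.sub i2).sub i3).sub i4).add i5).add ((i6.sub i7).const_mul (m c))).add
      ((i8.sub i9).const_mul (m b)))
    (((LocBddMeasurable.const f).mul hθ).intervalIntegrable 0 1) hpt
  rw [intervalIntegral.integral_add (((((i1.sub i2).sub i3).sub i4).add i5).add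
      ((i6.sub i7).const_mul (m c))) ((i8.sub i9).const_mul (m b)),
    intervalIntegral.integral_add ((((i1.sub i2).sub i3).sub i4).add i5)
      ((i6.sub i7).const_mul (m c)),
    intervalIntegral.integral_add (((i1.sub i2).sub i3).sub i4) i5,
    intervalIntegral.integral_sub ((i1.sub i2).sub i3) i4,
    intervalIntegral.integral_sub (i1.sub i2) i3, intervalIntegral.integral_sub i1 i2,
    intervalIntegral.integral_const_mul, intervalIntegral.integral_const_mul,
    intervalIntegral.integral_const_mul, intervalIntegral.integral_const_mul,
    intervalIntegral.integral_const_mul, intervalIntegral.integral_sub i6 i7,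
    intervalIntegral.integral_sub i8 i9, h.primitive 1 (by simp), h.total,
    integral_zero_one_ite_le hθ a0.le (by linarith), h.primitive a ⟨a0.le, by linarith⟩] at hint
  have hν79 : (∫ x in (0 : ℝ)..1, if x ≤ b then ν x else 0)
      + (∫ x in (0 : ℝ)..1, if x ≤ b then 0 else ν x) = ∫ x in (0 : ℝ)..1, ν x := by
    rw [← intervalIntegral.integral_add i7 i9]
    congr 1 with x
    split_ifs <;> simp
  have hS68 : (∫ x in (0 : ℝ)..1, if x ≤ c then θ x * S x else 0)
      + (∫ x in (0 : ℝ)..1, if x ≤ c then 0 else θ x * S x)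
      = ∫ x in (0 : ℝ)..1, s x * (γf - P x) := by
    rw [← intervalIntegral.integral_add i6 i8]
    have e1 : ∀ x, (if x ≤ c then θ x * S x else 0) + (if x ≤ c then 0 else θ x * S x)
        = θ x * S x := fun x => by split_ifs <;> simp
    simp only [e1]
    rw [hSdef, integral_mul_primitive hθ hs]
    exact integral_congr_Ioo_of_le zero_le_one fun y hy => by
      simp only [htail y ⟨hy.1.le, hy.2.le⟩]
  have hν9 := integral_zero_one_ite_gt hν hb1.1.le hb1.2
  -- Beyond `c` no share is added and shares are at most one, so `S ≤ c` there.
  have hB : (∫ x in (0 : ℝ)..1, if x ≤ c then 0 else θ x * S x) ≤ (γf - P c) * c := by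
    have e1 : ∫ x in (0 : ℝ)..1, c * (if x ≤ c then 0 else θ x) = (γf - P c) * c := by
      rw [intervalIntegral.integral_const_mul, integral_zero_one_ite_gt hθ hc1.1.le hc1.2,
        htail c ⟨hc1.1.le, hc1.2⟩, mul_comm]
    rw [← e1]
    refine integral_mono_on_of_le_Ioo zero_le_one i8
      (((LocBddMeasurable.const c).mul (hz.ite_le c hθ)).intervalIntegrable 0 1) fun x hx => ?_
    split_ifs with hxc
    · simp
    · rw [mul_comm c]
      exact mul_le_mul_of_nonneg_left (hSc x ⟨not_le.1 hxc, hx.2.le⟩)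
        (h.θ_nonneg x ⟨hx.1, hx.2.le⟩)
  have hm12 := h.balance
  -- By `balance_late` the coefficient of `m b` is nonpositive; by `balance` the two coefficients
  -- have a nonnegative sum. Hence that of `m c` is nonnegative, and `m c` may be lowered to `m b`.
  have hbal : 0 ≤ m c * ((∫ x in (0 : ℝ)..1, if x ≤ c then θ x * S x else 0)
        - ∫ x in (0 : ℝ)..1, if x ≤ b then ν x else 0)
      + m b * ((∫ x in (0 : ℝ)..1, if x ≤ c then 0 else θ x * S x)
        - ∫ x in (0 : ℝ)..1, if x ≤ b then 0 else ν x) := by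
    have hl := h.balance_late
    have h1 : 0 ≤ (∫ x in (0 : ℝ)..1, if x ≤ c then θ x * S x else 0)
        - ∫ x in (0 : ℝ)..1, if x ≤ b then ν x else 0 := by linarith
    have h2 := mul_le_mul_of_nonneg_right hcb h1
    have h3 : 0 ≤ m b * (((∫ x in (0 : ℝ)..1, if x ≤ c then θ x * S x else 0)
        - ∫ x in (0 : ℝ)..1, if x ≤ b then ν x else 0)
        + ((∫ x in (0 : ℝ)..1, if x ≤ c then 0 else θ x * S x)
        - ∫ x in (0 : ℝ)..1, if x ≤ b then 0 else ν x)) :=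
      mul_nonneg (hm0 b hb1) (by linarith)
    linarith
  have hD3 : ∫ x in (0 : ℝ)..1, θ x * D x
      = ∫ x in (0 : ℝ)..1, s x * d x * (γf - ∫ y in (0 : ℝ)..x, θ y) := by
    rw [hDdef, integral_mul_primitive hθ hsd]
    exact integral_congr_Ioo_of_le zero_le_one fun y hy => by
      simp only [htail y ⟨hy.1.le, hy.2.le⟩, h.primitive y ⟨hy.1.le, hy.2.le⟩]
  have hE4 : ∫ x in (0 : ℝ)..1, θ x * E x
      = ∫ x in (0 : ℝ)..1, d x * ∫ y in (0 : ℝ)..x, θ y := (integral_mul_primitive hd hθ).symm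
  -- After Fubini, `d x` is charged `2 s x` by each later constraint and once by each earlier one;
  -- for `x > b` the constraints at positions up to `a` leave it out, which saves `P a`.
  have hdist : (∫ x in (0 : ℝ)..1, ν x * d x) + 2 * (∫ x in (0 : ℝ)..1, θ x * D x)
      + (∫ x in (0 : ℝ)..1, θ x * E x) - P a * E b ≤ γc * ∫ x in (0 : ℝ)..1, d x := by
    have j3 := ((hsd.mul ((LocBddMeasurable.const γf).sub hPr)).intervalIntegrable 0 1).const_mul 2
    have j4 := (hd.mul hPr).intervalIntegrable 0 1
    have j5 := ((hz.ite_le b hd).intervalIntegrable 0 1).const_mul (P a)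
    have hEb : E b = ∫ x in (0 : ℝ)..1, (if x ≤ b then 0 else d x) :=
      (integral_zero_one_ite_gt hd hb1.1.le hb1.2).symm
    rw [hD3, hE4, hEb,
      ← intervalIntegral.integral_const_mul, ← intervalIntegral.integral_const_mul,
      ← intervalIntegral.integral_const_mul, ← intervalIntegral.integral_add i2 j3,
      ← intervalIntegral.integral_add (i2.add j3) j4,
      ← intervalIntegral.integral_sub ((i2.add j3).add j4) j5]
    refine integral_mono_on_of_le_Ioo zero_le_one (((i2.add j3).add j4).sub j5)
      ((hd.intervalIntegrable 0 1).const_mul γc) fun x hx => ?_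
    have hdx := hd0 x ⟨hx.1, hx.2.le⟩
    simp only [h.primitive x ⟨hx.1.le, hx.2.le⟩]
    by_cases hxb : x ≤ b
    · simp only [hxb, if_true]
      have := mul_le_mul_of_nonneg_right (h.dist_early x ⟨hx.1, hxb⟩) hdx
      linarith
    · simp only [hxb, if_false]
      have hxb' := not_le.1 hxb
      rw [h.s_eq_zero x ⟨by linarith, hx.2.le⟩]
      have := mul_le_mul_of_nonneg_right (h.dist_late x ⟨hxb', hx.2.le⟩) hdx
      linarith
  linarith

end Continuum

/-! ### The explicit dual solution -/

section Certificate

open MeasureTheory Set intervalIntegral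

lemma LocBddMeasurable.ite_Icc {u v w : ℝ → ℝ} {p q : ℝ} (hpq : p ≤ q)
    (hu : ContinuousOn u (Icc p q)) (hv : LocBddMeasurable v) (hw : LocBddMeasurable w) :
    LocBddMeasurable fun x => if x ≤ p then v x else if x ≤ q then u x else w x := by
  have h1 : LocBddMeasurable (IccExtend hpq ((Icc p q).domRestrict u)) :=
    of_continuous (hu.domRestrict.Icc_extend')
  have h2 : (fun x => if x ≤ p then v x else if x ≤ q then u x else w x) =
      fun x => if x ≤ p then v x else
        if x ≤ q then IccExtend hpq ((Icc p q).domRestrict u) x else w x := by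
    funext x
    split_ifs with h3 h4
    · rfl
    · rw [IccExtend_of_mem hpq _ ⟨(not_le.1 h3).le, h4⟩]; rfl
    · rfl
  rw [h2]
  exact hv.ite_le p (h1.ite_le q hw)

lemma integral_eq_sub_of_eqOn_Ioo {u u' Q : ℝ → ℝ} {p y : ℝ} (hpy : p ≤ y)
    (h : ∀ x ∈ Ioo p y, u x = u' x) (hQ : ∀ x ∈ Icc p y, HasDerivAt Q (u' x) x)
    (hc : ContinuousOn u' (Icc p y)) : ∫ x in p..y, u x = Q y - Q p := by
  rw [integral_congr_Ioo_of_le hpy h]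
  rw [← uIcc_of_le hpy] at hQ hc
  exact integral_eq_sub_of_hasDerivAt hQ hc.intervalIntegrable

namespace JMSCertificate

/-- The local coordinate on the first piece. -/
noncomputable def loc (x : ℝ) : ℝ := (880 * x - 99) / 606

/-- Ideally `1 / (141 / 176 - x)`. Since `141 / 176 - x = 303 / 440 * (1 - loc x)`, this is a
geometric series in `loc x`; truncating it keeps the primitive polynomial. On `[0, 9 / 40]` the
coordinate `loc` runs over the symmetric range `[-33 / 202, 33 / 202]`. The leading factor, slightly
above one, makes the total weight of the piece exactly `33 / 100` and also absorbs the truncation.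
-/
noncomputable def weight₁ (x : ℝ) : ℝ :=
  1030301 / 1029175 * (440 / 303) * (1 + loc x + loc x ^ 2 + loc x ^ 3)

/-- A linear majorant of `1 / (1 - x)` on its piece. It reaches `36 / 25` at `11 / 36` with
cumulative weight `11 / 25` there, so that the cumulative weight continues as `36 / 25 * x`. -/
noncomputable def weight₂ (x : ℝ) : ℝ := 936 / 725 + 7776 / 4205 * (x - 9 / 40)

/-- The profile for which, with zero share, both the budget and the distance constraint are tight.
The constant makes the cumulative weight continuous at `11 / 16`, where it is `99 / 100`; it reaches
`111 / 100` at `141 / 176`. -/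
noncomputable def weight₄ (x : ℝ) : ℝ := 21 / 320 / (1 - x) ^ 2

/-- The subtracted constant is the value of the polynomial at `loc 0 = -33 / 202`. -/
noncomputable def cumWeight₁ (x : ℝ) : ℝ :=
  1030301 / 1029175 * ((loc x + loc x ^ 2 / 2 + loc x ^ 3 / 3 + loc x ^ 4 / 4)
    - (-(33 / 202) + (33 / 202) ^ 2 / 2 - (33 / 202) ^ 3 / 3 + (33 / 202) ^ 4 / 4))

noncomputable def cumWeight₂ (x : ℝ) : ℝ :=
  33 / 100 + 936 / 725 * (x - 9 / 40) + 3888 / 4205 * (x - 9 / 40) ^ 2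

noncomputable def cumWeight₄ (x : ℝ) : ℝ := 39 / 50 + 21 / 320 / (1 - x)

/-- The weights of the constraints. -/
noncomputable def weight (x : ℝ) : ℝ :=
  if x ≤ 9 / 40 then weight₁ x else if x ≤ 11 / 36 then weight₂ x
  else if x ≤ 11 / 16 then 36 / 25 else if x ≤ 141 / 176 then weight₄ x else 0

/-- The total weight of the constraints up to a position. -/
noncomputable def cumWeight (x : ℝ) : ℝ :=
  if x ≤ 9 / 40 then cumWeight₁ x else if x ≤ 11 / 36 then cumWeight₂ x
  else if x ≤ 11 / 16 then 36 / 25 * x else if x ≤ 141 / 176 then cumWeight₄ x else 111 / 100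

/-- The shares of the earlier clients. -/
noncomputable def share (x : ℝ) : ℝ :=
  if x ≤ 0 then 0
  else if x ≤ 9 / 40 then (89 / 50 - cumWeight₁ x) / (2 * (111 / 100 - cumWeight₁ x))
  else if x ≤ 11 / 36 then (89 / 50 - cumWeight₂ x) / (2 * (111 / 100 - cumWeight₂ x))
  else if x ≤ 11 / 16 then 1 else 0

/-- The weights of the triangle inequalities. -/
noncomputable def triWeight (x : ℝ) : ℝ :=
  if x ≤ 11 / 36 then 0 else if x ≤ 11 / 16 then 1 - 36 / 25 * (1 - x)
  else if x ≤ 141 / 176 then 1 - 21 / 320 / (1 - x) else 1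

lemma continuous_loc : Continuous loc := by unfold loc; fun_prop

lemma continuous_weight₁ : Continuous weight₁ := by
  have := continuous_loc
  unfold weight₁
  fun_prop

lemma continuous_weight₂ : Continuous weight₂ := by unfold weight₂; fun_prop

lemma continuous_cumWeight₁ : Continuous cumWeight₁ := by
  have := continuous_loc
  unfold cumWeight₁
  fun_prop

lemma continuous_cumWeight₂ : Continuous cumWeight₂ := by unfold cumWeight₂; fun_prop

lemma continuousOn_weight₄ : ContinuousOn weight₄ (Icc (11 / 16) (141 / 176)) := by
  unfold weight₄
  exact continuousOn_const.div (by fun_prop) fun x hx => by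
    have : 0 < 1 - x := by linarith [hx.2]
    positivity

lemma continuousOn_inv_one_sub :
    ContinuousOn (fun x : ℝ => 1 - 21 / 320 / (1 - x)) (Icc (11 / 16) (141 / 176)) :=
  continuousOn_const.sub (continuousOn_const.div (by fun_prop) fun x hx => by linarith [hx.2])

lemma hasDerivAt_loc (x : ℝ) : HasDerivAt loc (440 / 303) x := by
  have h := (((hasDerivAt_id x).const_mul 880).sub_const 99).div_const 606
  exact HasDerivAt.congr_deriv (f := loc) h (by norm_num)

lemma hasDerivAt_cumWeight₁ (x : ℝ) : HasDerivAt cumWeight₁ (weight₁ x) x := by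
  have h := hasDerivAt_loc x
  have h' := ((((h.add ((h.pow 2).div_const 2)).add ((h.pow 3).div_const 3)).add
    ((h.pow 4).div_const 4)).sub_const
    (-(33 / 202) + (33 / 202) ^ 2 / 2 - (33 / 202) ^ 3 / 3 + (33 / 202) ^ 4 / 4)).const_mul
    (1030301 / 1029175)
  refine HasDerivAt.congr_deriv (f := cumWeight₁) h' ?_
  unfold weight₁
  push_cast
  ring

lemma hasDerivAt_cumWeight₂ (x : ℝ) : HasDerivAt cumWeight₂ (weight₂ x) x := by
  have h := (hasDerivAt_id x).sub_const (9 / 40)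
  have h' := ((h.const_mul (936 / 725)).const_add (33 / 100)).add
    ((h.pow 2).const_mul (3888 / 4205))
  refine HasDerivAt.congr_deriv (f := cumWeight₂) h' ?_
  unfold weight₂
  push_cast
  simp only [id]
  ring

lemma hasDerivAt_cumWeight₄ {x : ℝ} (hx : x < 1) : HasDerivAt cumWeight₄ (weight₄ x) x := by
  have h : (1 - x) ≠ 0 := by linarith
  have h' := ((((hasDerivAt_id x).const_sub 1).inv h).const_mul (21 / 320)).const_add (39 / 50)
  refine HasDerivAt.congr_deriv (f := cumWeight₄) h' ?_
  unfold weight₄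
  simp only [id]
  field_simp

/-- An antiderivative of `cumWeight₁`. -/
noncomputable def cumInt₁ (x : ℝ) : ℝ :=
  1030301 / 1029175 * (303 / 440 *
    (loc x ^ 2 / 2 + loc x ^ 3 / 6 + loc x ^ 4 / 12 + loc x ^ 5 / 20)
    - (-(33 / 202) + (33 / 202) ^ 2 / 2 - (33 / 202) ^ 3 / 3 + (33 / 202) ^ 4 / 4) * x)

/-- An antiderivative of `cumWeight₂`. -/
noncomputable def cumInt₂ (x : ℝ) : ℝ :=
  33 / 100 * (x - 9 / 40) + 468 / 725 * (x - 9 / 40) ^ 2 + 1296 / 4205 * (x - 9 / 40) ^ 3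

lemma hasDerivAt_cumInt₁ (x : ℝ) : HasDerivAt cumInt₁ (cumWeight₁ x) x := by
  have h := hasDerivAt_loc x
  have h' := ((((((h.pow 2).div_const 2).add ((h.pow 3).div_const 6)).add
    ((h.pow 4).div_const 12)).add ((h.pow 5).div_const 20)).const_mul (303 / 440)).sub
    ((hasDerivAt_id x).const_mul
      (-(33 / 202) + (33 / 202) ^ 2 / 2 - (33 / 202) ^ 3 / 3 + (33 / 202) ^ 4 / 4))
  have h'' := h'.const_mul (1030301 / 1029175)
  refine HasDerivAt.congr_deriv (f := cumInt₁) h'' ?_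
  unfold cumWeight₁
  push_cast
  ring

lemma hasDerivAt_cumInt₂ (x : ℝ) : HasDerivAt cumInt₂ (cumWeight₂ x) x := by
  have h := (hasDerivAt_id x).sub_const (9 / 40)
  have h' := ((h.const_mul (33 / 100)).add ((h.pow 2).const_mul (468 / 725))).add
    ((h.pow 3).const_mul (1296 / 4205))
  refine HasDerivAt.congr_deriv (f := cumInt₂) h' ?_
  unfold cumWeight₂
  push_cast
  simp only [id]
  ring

lemma cumWeight₁_le {x : ℝ} (h0 : 0 ≤ x) (h1 : x ≤ 9 / 40) : cumWeight₁ x ≤ 11 / 25 := by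
  have hy : |loc x| ≤ 33 / 202 := by
    unfold loc
    rw [abs_le]
    constructor <;> linarith
  have e1 := (abs_le.1 hy).2
  have e2 : loc x ^ 2 ≤ (33 / 202) ^ 2 := by
    rw [← sq_abs]; gcongr
  have e3 : loc x ^ 3 ≤ (33 / 202) ^ 3 :=
    (le_abs_self _).trans (by rw [abs_pow]; gcongr)
  have e4 : loc x ^ 4 ≤ (33 / 202) ^ 4 :=
    (le_abs_self _).trans (by rw [abs_pow]; gcongr)
  unfold cumWeight₁
  norm_num at e2 e3 e4 ⊢
  linarith

lemma cumWeight₂_le {x : ℝ} (h0 : 9 / 40 ≤ x) (h1 : x ≤ 11 / 36) : cumWeight₂ x ≤ 11 / 25 := by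
  have e : (x - 9 / 40) ^ 2 ≤ (29 / 360) * (x - 9 / 40) := by nlinarith
  unfold cumWeight₂
  linarith

/-- The geometric sum telescopes to `1 - loc x ^ 4`, and the leading factor outweighs the loss of at
most `(33 / 202) ^ 4`. -/
lemma weight₁_mul {x : ℝ} (h0 : 0 ≤ x) (h1 : x ≤ 9 / 40) : 1 ≤ weight₁ x * (141 / 176 - x) := by
  have hy : |loc x| ≤ 33 / 202 := by
    unfold loc
    rw [abs_le]
    constructor <;> linarith
  have e4 : loc x ^ 4 ≤ (33 / 202) ^ 4 :=
    (le_abs_self _).trans (by rw [abs_pow]; gcongr)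
  have e : weight₁ x * (141 / 176 - x) = 1030301 / 1029175 * (1 - loc x ^ 4) := by
    unfold weight₁ loc
    ring
  rw [e]
  norm_num at e4 ⊢
  linarith

/-- The right-hand side is a concave quadratic in `x`, and the inequality holds at both ends of the
piece, with equality at `11 / 36`. -/
lemma weight₂_mul {x : ℝ} (h0 : 9 / 40 ≤ x) (h1 : x ≤ 11 / 36) : 1 ≤ weight₂ x * (1 - x) := by
  unfold weight₂
  nlinarith [mul_nonneg (sub_nonneg.2 h0) (sub_nonneg.2 h1)]

/-- The threshold `11 / 25` is the cumulative weight at which the share that makes the distance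
constraint tight reaches one. This is why the formula for `share` changes at `11 / 36`. -/
lemma share_mem {p : ℝ} (hp : p ≤ 11 / 25) :
    0 ≤ (89 / 50 - p) / (2 * (111 / 100 - p)) ∧ (89 / 50 - p) / (2 * (111 / 100 - p)) ≤ 1 :=
  ⟨div_nonneg (by linarith) (by linarith), (div_le_one (by linarith)).2 (by linarith)⟩

lemma share_mul {p : ℝ} (hp : p ≤ 11 / 25) :
    (89 / 50 - p) / (2 * (111 / 100 - p)) * (111 / 100 - p) = (89 / 50 - p) / 2 := by
  have : 111 / 100 - p ≠ 0 := by linarith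
  rw [mul_comm 2, ← div_div, div_mul_eq_mul_div, div_mul_cancel₀ _ this]

lemma continuousOn_share {P : ℝ → ℝ} {p q : ℝ} (hP : Continuous P)
    (h : ∀ x, p ≤ x → x ≤ q → P x ≤ 11 / 25) :
    ContinuousOn (fun x => (89 / 50 - P x) / (2 * (111 / 100 - P x))) (Icc p q) :=
  ContinuousOn.div (by fun_prop) (by fun_prop) fun x hx => by
    have := h x hx.1 hx.2
    linarith

lemma weight_meas : LocBddMeasurable weight :=
  (LocBddMeasurable.of_continuous continuous_weight₁).ite_le _
    ((LocBddMeasurable.of_continuous continuous_weight₂).ite_le _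
      (LocBddMeasurable.ite_Icc (by norm_num) continuousOn_weight₄ (LocBddMeasurable.const _)
        (LocBddMeasurable.const _)))

lemma share_meas : LocBddMeasurable share := by
  have h := LocBddMeasurable.ite_Icc (p := 0) (q := 9 / 40) (by norm_num)
    (continuousOn_share continuous_cumWeight₁ fun x => cumWeight₁_le) (LocBddMeasurable.const 0)
    (LocBddMeasurable.ite_Icc (p := 9 / 40) (q := 11 / 36) (by norm_num)
    (continuousOn_share continuous_cumWeight₂ fun x => cumWeight₂_le)
    (LocBddMeasurable.const 0) ((LocBddMeasurable.const 1).ite_le (11 / 16)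
      (LocBddMeasurable.const 0)))
  refine Eq.mp (congrArg LocBddMeasurable (funext fun x => ?_)) h
  unfold share
  split_ifs <;> rfl

lemma triWeight_meas : LocBddMeasurable triWeight :=
  (LocBddMeasurable.const _).ite_le _ (LocBddMeasurable.ite_Icc (by norm_num)
    continuousOn_inv_one_sub (LocBddMeasurable.of_continuous (by fun_prop))
    (LocBddMeasurable.const _))

lemma integral_weight₁ {y : ℝ} (h0 : 0 ≤ y) (h1 : y ≤ 9 / 40) :
    ∫ x in (0 : ℝ)..y, weight x = cumWeight₁ y := by
  rw [integral_eq_sub_of_eqOn_Ioo h0 (u := weight) (u' := weight₁) (Q := cumWeight₁)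
    (fun x hx => if_pos (by linarith [hx.2])) (fun x _ => hasDerivAt_cumWeight₁ x)
    continuous_weight₁.continuousOn, sub_eq_self]
  norm_num [cumWeight₁, loc]

lemma integral_weight₂ {y : ℝ} (h0 : 9 / 40 ≤ y) (h1 : y ≤ 11 / 36) :
    ∫ x in (0 : ℝ)..y, weight x = cumWeight₂ y := by
  rw [← integral_add_adjacent_intervals (weight_meas.intervalIntegrable 0 (9 / 40))
    (weight_meas.intervalIntegrable _ _), integral_weight₁ (by norm_num) le_rfl,
    integral_eq_sub_of_eqOn_Ioo h0 (u' := weight₂) (Q := cumWeight₂)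
    (fun x hx => by
      unfold weight
      rw [if_neg (by linarith [hx.1]), if_pos (by linarith [hx.2])])
    (fun x _ => hasDerivAt_cumWeight₂ x) continuous_weight₂.continuousOn]
  norm_num [cumWeight₁, cumWeight₂, loc]

lemma integral_weight₃ {y : ℝ} (h0 : 11 / 36 ≤ y) (h1 : y ≤ 11 / 16) :
    ∫ x in (0 : ℝ)..y, weight x = 36 / 25 * y := by
  rw [← integral_add_adjacent_intervals (weight_meas.intervalIntegrable 0 (11 / 36))
    (weight_meas.intervalIntegrable _ _), integral_weight₂ (by norm_num) le_rfl,
    integral_eq_sub_of_eqOn_Ioo h0 (u' := fun _ => 36 / 25) (Q := fun x => 36 / 25 * x)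
    (fun x hx => by
      unfold weight
      rw [if_neg (by linarith [hx.1]), if_neg (by linarith [hx.1]), if_pos (by linarith [hx.2])])
    (fun x _ => hasDerivAt_const_mul _) continuousOn_const]
  norm_num [cumWeight₂]

lemma integral_weight₄ {y : ℝ} (h0 : 11 / 16 ≤ y) (h1 : y ≤ 141 / 176) :
    ∫ x in (0 : ℝ)..y, weight x = cumWeight₄ y := by
  rw [← integral_add_adjacent_intervals (weight_meas.intervalIntegrable 0 (11 / 16))
    (weight_meas.intervalIntegrable _ _), integral_weight₃ (by norm_num) le_rfl,
    integral_eq_sub_of_eqOn_Ioo h0 (u' := weight₄) (Q := cumWeight₄)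
    (fun x hx => by
      unfold weight
      rw [if_neg (by linarith [hx.1]), if_neg (by linarith [hx.1]), if_neg (by linarith [hx.1]),
        if_pos (by linarith [hx.2])])
    (fun x hx => hasDerivAt_cumWeight₄ (by linarith [hx.2]))
    (continuousOn_weight₄.mono (Icc_subset_Icc_right h1))]
  norm_num [cumWeight₄]

lemma integral_weight₅ {y : ℝ} (h0 : 141 / 176 ≤ y) :
    ∫ x in (0 : ℝ)..y, weight x = 111 / 100 := by
  rw [← integral_add_adjacent_intervals (weight_meas.intervalIntegrable 0 (141 / 176))
    (weight_meas.intervalIntegrable _ _), integral_weight₄ (by norm_num) le_rfl,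
    integral_eq_sub_of_eqOn_Ioo h0 (u' := fun _ => 0) (Q := fun _ => 0)
    (fun x hx => by
      unfold weight
      rw [if_neg (by linarith [hx.1]), if_neg (by linarith [hx.1]), if_neg (by linarith [hx.1]),
        if_neg (by linarith [hx.1])])
    (fun x _ => hasDerivAt_const _ _) continuousOn_const]
  norm_num [cumWeight₄]

lemma integral_weight {y : ℝ} (h0 : 0 ≤ y) : ∫ x in (0 : ℝ)..y, weight x = cumWeight y := by
  unfold cumWeight
  split_ifs with h1 h2 h3 h4
  · exact integral_weight₁ h0 h1
  · exact integral_weight₂ (not_le.1 h1).le h2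
  · exact integral_weight₃ (not_le.1 h2).le h3
  · exact integral_weight₄ (not_le.1 h3).le h4
  · exact integral_weight₅ (not_le.1 h4).le

lemma integral_triWeight_late :
    ∫ x in (141 / 176 : ℝ)..1, triWeight x = 35 / 176 := by
  rw [integral_eq_sub_of_eqOn_Ioo (by norm_num) (u' := fun _ => 1) (Q := fun x => x)
    (fun x hx => by
      unfold triWeight
      rw [if_neg (by linarith [hx.1]), if_neg (by linarith [hx.1]), if_neg (by linarith [hx.1])])
    (fun x _ => hasDerivAt_id x) continuousOn_const]
  norm_num

/-- Together with `le_integral_share` this gives the balance condition; the gap between `0.3887` and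
`0.3895` is the slack left after rounding. -/
lemma integral_triWeight_le :
    ∫ x in (0 : ℝ)..1, triWeight x ≤ 3887 / 10000 := by
  have hI := triWeight_meas.intervalIntegrable
  have e1 : ∫ x in (0 : ℝ)..(11 / 36), triWeight x = 0 := by
    rw [integral_eq_sub_of_eqOn_Ioo (by norm_num) (u := triWeight) (u' := fun _ => 0)
      (Q := fun _ => 0) (fun x hx => if_pos hx.2.le) (fun x _ => hasDerivAt_const _ _) continuousOn_const]
    norm_num
  have e2 : ∫ x in (11 / 36 : ℝ)..(11 / 16), triWeight x
      = (-(11 / 25) * (11 / 16) + 18 / 25 * (11 / 16) ^ 2)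
        - (-(11 / 25) * (11 / 36) + 18 / 25 * (11 / 36) ^ 2) := by
    rw [integral_eq_sub_of_eqOn_Ioo (by norm_num) (u' := fun x => 1 - 36 / 25 * (1 - x))
      (Q := fun x => -(11 / 25) * x + 18 / 25 * x ^ 2)
      (fun x hx => by
        unfold triWeight
        rw [if_neg (by linarith [hx.1]), if_pos (by linarith [hx.2])])
      (fun x _ => ?_) (by fun_prop)]
    refine HasDerivAt.congr_deriv (((hasDerivAt_id x).const_mul (-(11 / 25))).add
      (((hasDerivAt_id x).pow 2).const_mul (18 / 25))) ?_
    simp only [id]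
    push_cast
    ring
  have e3 : ∫ x in (11 / 16 : ℝ)..(141 / 176), triWeight x
      = (141 / 176 + 21 / 320 * Real.log (1 - 141 / 176))
        - (11 / 16 + 21 / 320 * Real.log (1 - 11 / 16)) := by
    rw [integral_eq_sub_of_eqOn_Ioo (by norm_num) (u' := fun x => 1 - 21 / 320 / (1 - x))
      (Q := fun x => x + 21 / 320 * Real.log (1 - x))
      (fun x hx => by
        unfold triWeight
        rw [if_neg (by linarith [hx.1]), if_neg (by linarith [hx.1]), if_pos (by linarith [hx.2])])
      (fun x hx => ?_) continuousOn_inv_one_sub]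
    have hx1 : (1 - x) ≠ 0 := by linarith [hx.2]
    refine HasDerivAt.congr_deriv ((hasDerivAt_id x).add
      ((((hasDerivAt_id x).const_sub 1).log hx1).const_mul (21 / 320))) ?_
    simp only [id]
    ring
  -- The ratio of the arguments is `11 / 7`, and `log (1 + x) ≥ 2 x / (x + 2)` at `x = 4 / 7` gives
  -- `4 / 9`.
  have hlog : 4 / 9 ≤ Real.log (1 - 11 / 16) - Real.log (1 - 141 / 176) := by
    rw [← Real.log_div (by norm_num) (by norm_num)]
    have := Real.le_log_one_add_of_nonneg (x := 4 / 7) (by norm_num)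
    norm_num at this ⊢
    exact this
  rw [← integral_add_adjacent_intervals (hI 0 (11 / 36)) (hI (11 / 36) 1),
    ← integral_add_adjacent_intervals (hI (11 / 36) (11 / 16)) (hI (11 / 16) 1),
    ← integral_add_adjacent_intervals (hI (11 / 16) (141 / 176)) (hI (141 / 176) 1),
    e1, e2, e3, integral_triWeight_late]
  norm_num at hlog ⊢
  linarith

lemma cumWeight_meas : LocBddMeasurable cumWeight := by
  refine (LocBddMeasurable.of_continuous continuous_cumWeight₁).ite_le _
    ((LocBddMeasurable.of_continuous continuous_cumWeight₂).ite_le _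
      (LocBddMeasurable.ite_Icc (by norm_num) ?_
        (LocBddMeasurable.of_continuous (by fun_prop)) (LocBddMeasurable.const _)))
  unfold cumWeight₄
  exact continuousOn_const.add (continuousOn_const.div (by fun_prop) fun x hx => by
    linarith [hx.2])

/-- Tightness of the distance constraint where `triWeight` vanishes. It also turns the integrand of
the balance condition into a polynomial. -/
lemma share_mul_early {x : ℝ} (h0 : 0 < x) (h1 : x ≤ 11 / 36) :
    share x * (111 / 100 - cumWeight x) = (89 / 50 - cumWeight x) / 2 := by
  unfold share cumWeight
  rw [if_neg (not_le.2 h0)]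
  split_ifs with h2
  · exact share_mul (cumWeight₁_le h0.le h2)
  · exact share_mul (cumWeight₂_le (not_le.1 h2).le h1)

lemma le_integral_share :
    3895 / 10000 ≤ ∫ x in (0 : ℝ)..1, share x * (111 / 100 - cumWeight x) := by
  have hI := (share_meas.mul
    ((LocBddMeasurable.const (111 / 100)).sub cumWeight_meas)).intervalIntegrable
  have e1 : ∫ x in (0 : ℝ)..(9 / 40), share x * (111 / 100 - cumWeight x)
      = (89 / 50 * (9 / 40) - cumInt₁ (9 / 40)) / 2 - (89 / 50 * 0 - cumInt₁ 0) / 2 :=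
    integral_eq_sub_of_eqOn_Ioo (by norm_num) (u' := fun x => (89 / 50 - cumWeight₁ x) / 2)
      (Q := fun x => (89 / 50 * x - cumInt₁ x) / 2)
      (fun x hx => by
        rw [share_mul_early hx.1 (by linarith [hx.2])]
        unfold cumWeight
        rw [if_pos hx.2.le])
      (fun x _ => ((hasDerivAt_const_mul _).sub (hasDerivAt_cumInt₁ x)).div_const 2)
      (by have := continuous_cumWeight₁; fun_prop)
  have e2 : ∫ x in (9 / 40 : ℝ)..(11 / 36), share x * (111 / 100 - cumWeight x)
      = (89 / 50 * (11 / 36) - cumInt₂ (11 / 36)) / 2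
        - (89 / 50 * (9 / 40) - cumInt₂ (9 / 40)) / 2 :=
    integral_eq_sub_of_eqOn_Ioo (by norm_num) (u' := fun x => (89 / 50 - cumWeight₂ x) / 2)
      (Q := fun x => (89 / 50 * x - cumInt₂ x) / 2)
      (fun x hx => by
        rw [share_mul_early (by linarith [hx.1]) hx.2.le]
        unfold cumWeight
        rw [if_neg (by linarith [hx.1]), if_pos hx.2.le])
      (fun x _ => ((hasDerivAt_const_mul _).sub (hasDerivAt_cumInt₂ x)).div_const 2)
      (by have := continuous_cumWeight₂; fun_prop)
  have e3 : ∫ x in (11 / 36 : ℝ)..(11 / 16), share x * (111 / 100 - cumWeight x)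
      = (111 / 100 * (11 / 16) - 18 / 25 * (11 / 16) ^ 2)
        - (111 / 100 * (11 / 36) - 18 / 25 * (11 / 36) ^ 2) := by
    rw [integral_eq_sub_of_eqOn_Ioo (by norm_num) (u' := fun x => 111 / 100 - 36 / 25 * x)
      (Q := fun x => 111 / 100 * x - 18 / 25 * x ^ 2)
      (fun x hx => by
        unfold share cumWeight
        rw [if_neg (by linarith [hx.1]), if_neg (by linarith [hx.1]), if_neg (by linarith [hx.1]),
          if_pos hx.2.le, if_neg (by linarith [hx.1]), if_neg (by linarith [hx.1]),
          if_pos hx.2.le, one_mul])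
      (fun x _ => ?_) (by fun_prop)]
    refine HasDerivAt.congr_deriv (((hasDerivAt_id x).const_mul (111 / 100)).sub
      (((hasDerivAt_id x).pow 2).const_mul (18 / 25))) ?_
    simp only [id]
    push_cast
    ring
  have e4 : ∫ x in (11 / 16 : ℝ)..1, share x * (111 / 100 - cumWeight x) = 0 - 0 :=
    integral_eq_sub_of_eqOn_Ioo (by norm_num) (u' := fun _ => 0) (Q := fun _ => 0)
      (fun x hx => by
        unfold share
        rw [if_neg (by linarith [hx.1]), if_neg (by linarith [hx.1]), if_neg (by linarith [hx.1]),
          if_neg (by linarith [hx.1]), zero_mul])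
      (fun x _ => hasDerivAt_const _ _) continuousOn_const
  rw [← integral_add_adjacent_intervals (hI 0 (9 / 40)) (hI (9 / 40) 1),
    ← integral_add_adjacent_intervals (hI (9 / 40) (11 / 36)) (hI (11 / 36) 1),
    ← integral_add_adjacent_intervals (hI (11 / 36) (11 / 16)) (hI (11 / 16) 1),
    e1, e2, e3, e4]
  norm_num [cumInt₁, cumInt₂, loc]

lemma share_nonneg (x : ℝ) (hx : 0 < x) : 0 ≤ share x := by
  unfold share
  split_ifs with h1 h2 h3
  · exact le_rfl
  · exact (share_mem (cumWeight₁_le hx.le h2)).1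
  · exact (share_mem (cumWeight₂_le (not_le.1 h2).le h3)).1
  · exact zero_le_one
  · exact le_rfl

lemma share_le_one (x : ℝ) (hx : 0 < x) : share x ≤ 1 := by
  unfold share
  split_ifs with h1 h2 h3
  · exact zero_le_one
  · exact (share_mem (cumWeight₁_le hx.le h2)).2
  · exact (share_mem (cumWeight₂_le (not_le.1 h2).le h3)).2
  · exact le_rfl
  · exact zero_le_one

lemma weight_nonneg (x : ℝ) (hx : 0 < x) : 0 ≤ weight x := by
  unfold weight
  split_ifs with h1 h2 h3 h4
  · have h := weight₁_mul hx.le h1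
    exact (pos_of_mul_pos_left (zero_lt_one.trans_le h) (by linarith)).le
  · have h := weight₂_mul (not_le.1 h1).le h2
    exact (pos_of_mul_pos_left (zero_lt_one.trans_le h) (by linarith)).le
  · norm_num
  · unfold weight₄
    positivity
  · exact le_rfl

lemma triWeight_nonneg (x : ℝ) : 0 ≤ triWeight x := by
  unfold triWeight
  split_ifs with h1 h2 h3
  · exact le_rfl
  · linarith
  · rw [sub_nonneg, div_le_one (by linarith)]
    linarith
  · exact zero_le_one

/-- Beyond `11 / 36` the clients between `11 / 36` and `x`, which have full share, suffice: `1 - 36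
/ 25 * (1 - x) = 36 / 25 * (x - 11 / 36)`. -/
lemma triWeight_le {x : ℝ} (hx : 0 < x) (hx1 : x ≤ 11 / 16) :
    triWeight x ≤ weight x * ∫ y in (0 : ℝ)..x, share y := by
  have hI := share_meas.intervalIntegrable
  have hz : ∀ z, 0 < z → 0 ≤ ∫ y in (0 : ℝ)..z, share y := fun z hz => by
    have := integral_mono_on_of_le_Ioo hz.le ((LocBddMeasurable.const 0).intervalIntegrable _ _)
      (hI 0 z) fun y hy => share_nonneg y hy.1
    simpa using this
  by_cases h : x ≤ 11 / 36
  · have e : triWeight x = 0 := if_pos h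
    rw [e]
    exact mul_nonneg (weight_nonneg x hx) (hz x hx)
  · have h' := not_le.1 h
    have e1 : ∫ y in (11 / 36 : ℝ)..x, share y = x - 11 / 36 :=
      integral_eq_sub_of_eqOn_Ioo h'.le (u' := fun _ => 1) (Q := fun y => y)
        (fun y hy => by
          unfold share
          rw [if_neg (by linarith [hy.1]), if_neg (by linarith [hy.1]),
            if_neg (by linarith [hy.1]), if_pos (by linarith [hy.2])])
        (fun y _ => hasDerivAt_id y) continuousOn_const
    have e2 := hz (11 / 36) (by norm_num)
    have e3 : weight x = 36 / 25 := by
      unfold weight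
      rw [if_neg (by linarith), if_neg h, if_pos hx1]
    have e4 : triWeight x = 1 - 36 / 25 * (1 - x) := by
      unfold triWeight
      rw [if_neg h, if_pos hx1]
    rw [← integral_add_adjacent_intervals (hI 0 (11 / 36)) (hI _ _), e1, e3, e4]
    linarith

/-- The certificate of the bifactor `(1.11, 1.78)`. -/
theorem dualCertificate : DualCertificate (111 / 100) (89 / 50) (9 / 40) (141 / 176) (11 / 16)
    weight share triWeight cumWeight where
  a_pos := by norm_num
  a_le := by norm_num
  c_le := by norm_num
  b_lt := by norm_num
  θ_meas := weight_meas
  s_meas := share_meas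
  ν_meas := triWeight_meas
  θ_nonneg := fun x hx => weight_nonneg x hx.1
  θ_eq_zero := fun x hx => by
    unfold weight
    rw [if_neg (by linarith [hx.1]), if_neg (by linarith [hx.1]), if_neg (by linarith [hx.1]),
      if_neg (by linarith [hx.1])]
  s_nonneg := fun x hx => share_nonneg x hx.1
  s_le_one := fun x hx => share_le_one x hx.1
  s_eq_zero := fun x hx => by
    unfold share
    rw [if_neg (by linarith [hx.1]), if_neg (by linarith [hx.1]), if_neg (by linarith [hx.1]),
      if_neg (by linarith [hx.1])]
  ν_nonneg := fun x _ => triWeight_nonneg x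
  primitive := fun y hy => integral_weight hy.1
  total := by norm_num [cumWeight]
  budget_early := fun x hx => by
    have h := weight₁_mul hx.1.le hx.2
    have e : weight x = weight₁ x := if_pos hx.2
    have := triWeight_nonneg x
    rw [e]
    linarith
  -- An equality from `11 / 36` on.
  budget_late := fun x hx => by
    have hx1 := hx.1
    unfold weight triWeight
    rw [if_neg (not_le.2 hx1)]
    split_ifs with h1 h2 h3
    · have := weight₂_mul hx1.le h1
      linarith
    · linarith
    · have : 1 - x ≠ 0 := by linarith
      unfold weight₄
      have e : 21 / 320 / (1 - x) ^ 2 * (1 - x) = 21 / 320 / (1 - x) := by field_simp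
      rw [e]
      linarith
    · simp
  -- An equality on all four pieces; the shares and the weights were solved for from it.
  dist_early := fun x hx => by
    by_cases h1 : x ≤ 11 / 36
    · have e : triWeight x = 0 := if_pos h1
      rw [share_mul_early hx.1 h1, e]
      linarith
    · have hx1 := not_le.1 h1
      have h0 : ¬ x ≤ 9 / 40 := by linarith
      have h0' : ¬ x ≤ 0 := by linarith
      unfold share cumWeight triWeight
      simp only [h0, h0', h1, if_false]
      split_ifs with h2 h3
      · linarith
      · unfold cumWeight₄
        linarith
      · exact absurd hx.2 h3
  -- Tight as well: `1.11 - 0.33 + 1 = 1.78`, which is why the first piece has total weight `33 /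
  -- 100`.
  dist_late := fun x hx => by
    have hx1 := hx.1
    have e1 : cumWeight (9 / 40) = 33 / 100 := by norm_num [cumWeight, cumWeight₁, loc]
    have e2 : cumWeight x = 111 / 100 := by
      unfold cumWeight
      rw [if_neg (by linarith), if_neg (by linarith), if_neg (by linarith), if_neg (by linarith)]
    have e3 : triWeight x = 1 := by
      unfold triWeight
      rw [if_neg (by linarith), if_neg (by linarith), if_neg (by linarith)]
    rw [e1, e2, e3]
    norm_num
  triangle := fun x hx => triWeight_le hx.1 hx.2
  balance := integral_triWeight_le.trans (le_trans (by norm_num) le_integral_share)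
  balance_late := by
    rw [integral_triWeight_late]
    norm_num [cumWeight]

end JMSCertificate

end Certificate

/-! ### From finite stars to the continuous program -/

section Discrete

open MeasureTheory Set intervalIntegral

/-- Weighted clients can be arranged along an interval in the order of their budgets. -/
lemma exists_arrangement {ι : Type*} [DecidableEq ι] [Nonempty ι] [MeasurableSpace ι]
    [DiscreteMeasurableSpace ι] [Finite ι] (α w : ι → ℝ) (hw : ∀ i, 0 ≤ w i) (T : Finset ι) :
    ∃ φ : ℝ → ι, Measurable φ ∧ (∀ x ∈ Ioc 0 (∑ i ∈ T, w i), φ x ∈ T) ∧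
      MonotoneOn (fun x => α (φ x)) (Ioc 0 (∑ i ∈ T, w i)) ∧
      ∀ g : ι → ℝ, ∫ x in (0 : ℝ)..(∑ i ∈ T, w i), g (φ x) = ∑ i ∈ T, w i * g i := by
  induction T using Finset.induction_on_max_value α with
  | empty => exact ⟨fun _ => Classical.arbitrary ι, measurable_const, by simp,
      fun _ _ _ _ _ => le_rfl, by simp⟩
  | insert a T haT hmax ih =>
    obtain ⟨φ, hφ, hmem, hmono, hint⟩ := ih
    set W := ∑ i ∈ T, w i with hW
    have hW0 : 0 ≤ W := Finset.sum_nonneg fun i _ => hw i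
    have hsum : ∑ i ∈ insert a T, w i = W + w a := by rw [Finset.sum_insert haT, add_comm]
    -- The client with the largest budget is appended as the interval `(W, W + w a]`.
    have hψ : Measurable fun x => if x ≤ W then φ x else a :=
      Measurable.ite measurableSet_Iic hφ measurable_const
    refine ⟨fun x => if x ≤ W then φ x else a, hψ, ?_, ?_, ?_⟩
    · intro x hx
      dsimp only
      split_ifs with h
      · exact Finset.mem_insert_of_mem (hmem x ⟨hx.1, h⟩)
      · exact Finset.mem_insert_self _ _
    · intro x hx y hy hxy
      simp only
      split_ifs with h1 h2 h2
      · exact hmono ⟨hx.1, h1⟩ ⟨hy.1, h2⟩ hxy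
      · exact hmax _ (hmem x ⟨hx.1, h1⟩)
      · exact absurd (hxy.trans h2) h1
      · exact le_rfl
    · intro g
      have hI := (LocBddMeasurable.comp_finite hψ g).intervalIntegrable
      rw [hsum, ← integral_add_adjacent_intervals (hI 0 W) (hI W _),
        integral_congr_Ioo_of_le (b := W) (g := fun x => g (φ x)) hW0 fun x hx => by simp [hx.2.le],
        integral_congr_Ioo_of_le (a := W) (g := fun _ => g a) (by linarith [hw a])
          fun x hx => by simp [not_le.2 hx.1],
        hint, Finset.sum_insert haT]
      simp [add_comm]

/-- The factor-revealing bound for weighted clients, with the earlier clients' offers bounded from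
below by means of the decreasing function `m`. -/
theorem sum_weight_mul_le {ι : Type*} [Fintype ι] {w α d : ι → ℝ} {m : ℝ → ℝ} {f : ℝ}
    (hw : ∀ j, 0 ≤ w j) (hα : ∀ j, 0 ≤ α j) (hd : ∀ j, 0 ≤ d j) (hf0 : 0 ≤ f)
    (hm : Antitone m) (hm0 : ∀ t, 0 ≤ m t) (hβ : ∀ j, α j - d j ≤ m (α j))
    (hM : ∀ j t, m t ≤ α j + d j)
    (hf : ∀ l, ∑ j, w j * (if α j < α l then max (m (α l) - 2 * d j) 0
      else max (α l - d j) 0) ≤ f) :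
    ∑ j, w j * α j ≤ 111 / 100 * f + 89 / 50 * ∑ j, w j * d j := by
  classical
  set W := ∑ j, w j
  rcases (Finset.sum_nonneg fun j _ => hw j : 0 ≤ W).eq_or_lt with hW0 | hW0
  · have h0 : ∀ j, w j = 0 := fun j =>
      (Finset.sum_eq_zero_iff_of_nonneg fun j _ => hw j).1 hW0.symm j (Finset.mem_univ j)
    simp only [h0, zero_mul, Finset.sum_const_zero]
    linarith
  have hne : Nonempty ι := by
    by_contra hempty
    rw [not_nonempty_iff] at hempty
    simp at hW0
  let _ : MeasurableSpace ι := ⊤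
  have hsum1 : ∑ j, w j / W = 1 := by rw [← Finset.sum_div, div_self hW0.ne']
  obtain ⟨φ, hφ, -, hmono, hint⟩ :=
    -- Weights are scaled to total one, which replaces `f` by `f / W`.
    exists_arrangement α (fun j => w j / W) (fun j => div_nonneg (hw j) hW0.le) Finset.univ
  rw [hsum1] at hmono hint
  have hint' : ∀ g : ι → ℝ, ∫ x in (0 : ℝ)..1, g (φ x) = (∑ j, w j * g j) / W := fun g => by
    rw [hint, Finset.sum_div]
    exact Finset.sum_congr rfl fun j _ => by ring
  have key := JMSCertificate.dualCertificate.integral_le (α := fun x => α (φ x))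
    (d := fun x => d (φ x)) (m := fun x => m (α (φ x))) (f := f / W)
    (LocBddMeasurable.comp_finite hφ α) (LocBddMeasurable.comp_finite hφ d)
    (fun x _ => hα _) (fun x _ => hd _) (fun x _ => hm0 _)
    (fun x hx y hy hxy => hm (hmono hx hy hxy)) (fun x _ => hβ _) ?_
  · rw [hint' α, hint' d] at key
    have h2 : (111 / 100 * (f / W) + 89 / 50 * ((∑ j, w j * d j) / W)) =
      (111 / 100 * f + 89 / 50 * ∑ j, w j * d j) / W := by ring
    rw [h2] at key
    exact (div_le_div_iff_of_pos_right hW0).1 key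
  · intro x hx l hl
    set G : ι → ℝ := fun j => if α j < α (φ x) then max (m (α (φ x)) - 2 * d j) 0
      else max (α (φ x) - d j) 0 with hG
    have hGI := (LocBddMeasurable.comp_finite hφ G).intervalIntegrable
    have hd' := LocBddMeasurable.comp_finite hφ d
    have hx1 : x ∈ Ioc (0 : ℝ) 1 := hx
    have e1 : ∫ y in (0 : ℝ)..x, JMSCertificate.share y * (m (α (φ x)) - 2 * d (φ y))
        ≤ ∫ y in (0 : ℝ)..x, G (φ y) := by
      refine integral_mono_on_of_le_Ioo hx.1.le
        ((JMSCertificate.share_meas.mul ((LocBddMeasurable.const _).sub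
          ((LocBddMeasurable.const 2).mul hd'))).intervalIntegrable _ _) (hGI _ _) fun y hy => ?_
      have hy1 : y ∈ Ioc (0 : ℝ) 1 := ⟨hy.1, by linarith [hy.2, hx.2]⟩
      have hs0 := JMSCertificate.share_nonneg y hy.1
      have hs1 := JMSCertificate.share_le_one y hy.1
      -- A share between zero and one of any real number is at most its positive part.
      have e : JMSCertificate.share y * (m (α (φ x)) - 2 * d (φ y))
          ≤ max (m (α (φ x)) - 2 * d (φ y)) 0 :=
        (mul_le_mul_of_nonneg_left (le_max_left _ 0) hs0).trans
          (mul_le_of_le_one_left (le_max_right _ _) hs1)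
      refine e.trans ?_
      simp only [hG]
      split_ifs with h
      · exact le_rfl
      -- Ties: `y` precedes `x` but has the same budget, so the sum counts it as not yet stopped.
      -- Its offer is still large enough because `m ≤ α + d`.
      · have h1 : α (φ y) ≤ α (φ x) := hmono hy1 hx1 hy.2.le
        have h2 := hM (φ y) (α (φ x))
        exact max_le_max (by linarith) le_rfl
    have e2 : ∫ y in x..l, (α (φ x) - d (φ y)) ≤ ∫ y in x..l, G (φ y) := by
      refine integral_mono_on_of_le_Ioo hl.1
        (((LocBddMeasurable.const _).sub hd').intervalIntegrable _ _) (hGI _ _) fun y hy => ?_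
      have hy1 : y ∈ Ioc (0 : ℝ) 1 := ⟨by linarith [hy.1, hx.1], by linarith [hy.2, hl.2]⟩
      simp only [hG]
      rw [if_neg (not_lt.2 (hmono hx1 hy1 hy.1.le))]
      exact le_max_left _ _
    have e3 : ∫ y in l..(1 : ℝ), (0 : ℝ) ≤ ∫ y in l..(1 : ℝ), G (φ y) := by
      refine integral_mono_on_of_le_Ioo hl.2
        ((LocBddMeasurable.const 0).intervalIntegrable _ _) (hGI _ _) fun y _ => ?_
      simp only [hG]
      split_ifs <;> exact le_max_right _ _
    have e4 := integral_add_adjacent_intervals (hGI 0 x) (hGI x l)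
    have e5 := integral_add_adjacent_intervals (hGI 0 l) (hGI l 1)
    rw [hint' G] at e5
    have e6 := (div_le_div_iff_of_pos_right hW0).2 (hf (φ x))
    simp only [intervalIntegral.integral_zero] at e3
    linarith

/-- The factor-revealing bound for a star of clients with final budgets `α` at the distances `d`
from a facility with opening cost `f`: at every time `t` at which some client is still active, the
earlier clients offer `R`, which is as much as for an unconnected client, or obeys the triangle
inequality. -/
theorem sum_budget_le {ι : Type*} [Fintype ι] {α d : ι → ℝ} {f : ℝ}
    (hα : ∀ j, 0 ≤ α j) (hd : ∀ j, 0 ≤ d j) (hf0 : 0 ≤ f)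
    (hf : ∀ t, (∃ l, t ≤ α l) → ∃ R : ι → ℝ,
      (∑ j, (if α j < t then R j else max (t - d j) 0) ≤ f) ∧
      ∀ j, α j < t → 0 ≤ R j ∧ (α j - d j ≤ R j ∨ ∀ l, t ≤ α l → α l - d l - 2 * d j ≤ R j)) :
    ∑ j, α j ≤ 111 / 100 * f + 89 / 50 * ∑ j, d j := by
  classical
  -- The supremum is taken in `NNReal`, so that it is zero when no client lasts until `t`.
  set mN : ℝ → NNReal := fun t =>
    (Finset.univ.filter fun l => t ≤ α l).sup fun l => (α l - d l).toNNReal with hmN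
  set m : ℝ → ℝ := fun t => (mN t : ℝ) with hmdef
  have hm0 : ∀ t, 0 ≤ m t := fun t => (mN t).2
  have hm : Antitone m := fun s t hst => by
    refine NNReal.coe_le_coe.2 (Finset.sup_mono fun l hl => ?_)
    simp only [Finset.mem_filter, Finset.mem_univ, true_and] at hl ⊢
    exact hst.trans hl
  have hle : ∀ t l, t ≤ α l → α l - d l ≤ m t := fun t l hl => by
    refine (Real.le_coe_toNNReal _).trans (NNReal.coe_le_coe.2 ?_)
    exact Finset.le_sup (f := fun l => (α l - d l).toNNReal) (by simpa using hl)
  have hmle : ∀ t r, 0 ≤ r → (∀ l, t ≤ α l → α l - d l ≤ r) → m t ≤ r := fun t r hr h => by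
    rw [← Real.coe_toNNReal r hr]
    refine NNReal.coe_le_coe.2 (Finset.sup_le fun l hl => Real.toNNReal_le_toNNReal (h l ?_))
    simpa using hl
  set M : ℝ := m 0 with hMdef
  have hmM : ∀ t, m t ≤ M := fun t =>
    hmle t M (hm0 0) fun l _ => hle 0 l (hα l)
  have hattain : 0 < M → ∃ i, M ≤ α i - d i := fun hpos => by
    by_contra! hlt
    rcases isEmpty_or_nonempty ι with he | hne
    · exact absurd (hmle 0 0 le_rfl fun l _ => (he.false l).elim) (not_le.2 hpos)
    · obtain ⟨i, hi⟩ := Finite.exists_max fun l => α l - d l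
      have h1 : M ≤ max (α i - d i) 0 :=
        hmle 0 _ (le_max_right _ _) fun l _ => (hi l).trans (le_max_left _ _)
      exact absurd h1 (not_le.2 (max_lt (hlt i) hpos))
  have hMm : ∀ t ≤ M, M ≤ m t := fun t ht => by
    rcases (hm0 0).eq_or_lt with h | h
    · exact h.symm.le.trans (hm0 t)
    · obtain ⟨i, hi⟩ := hattain h
      exact hi.trans (hle t i (by linarith [hd i]))
  -- The exchange for clients with `α j + d j < M`, whose frozen offer may be too small: the budget
  -- is raised to `M - d j`, where `α' + d = M`, and the weight scales the new maximal offer `M - 2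
  -- d j` down to the old offer `(α j - d j)⁺`.
  set w : ι → ℝ := fun j =>
    if α j + d j < M then max (α j - d j) 0 / (M - 2 * d j) else 1 with hwdef
  set α' : ι → ℝ := fun j => if α j + d j < M then M - d j else α j with hα'def
  have hwbad : ∀ j, α j + d j < M →
      0 ≤ w j ∧ w j ≤ 1 ∧ w j * max (M - 2 * d j) 0 = max (α j - d j) 0 := fun j hj => by
    simp only [hwdef, hj, if_true]
    rcases le_or_gt (α j) (d j) with h | h
    · rw [max_eq_right (by linarith : α j - d j ≤ 0)]
      simp
    · have h1 : 0 < M - 2 * d j := by linarith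
      rw [max_eq_left (by linarith : 0 ≤ α j - d j), max_eq_left h1.le]
      exact ⟨div_nonneg (by linarith) h1.le, (div_le_one h1).2 (by linarith),
        div_mul_cancel₀ _ h1.ne'⟩
  have hw0 : ∀ j, 0 ≤ w j := fun j => by
    by_cases hj : α j + d j < M
    · exact (hwbad j hj).1
    · simp [hwdef, hj]
  -- If `α j > d j`, then `w (M - 2 d) = α - d`, so the new value is `α - d - 0.78 w d`, and `w ≤ 1`
  -- finishes. If `α j ≤ d j`, the weight is zero and the old value is nonpositive.
  have hval : ∀ j, α j - 89 / 50 * d j ≤ w j * α' j - 89 / 50 * (w j * d j) := fun j => by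
    by_cases hj : α j + d j < M
    · obtain ⟨h0, h1, h2⟩ := hwbad j hj
      have e : α' j = M - d j := by simp [hα'def, hj]
      have h3 := mul_le_of_le_one_left (hd j) h1
      have hdj := hd j
      rw [e]
      rcases le_or_gt (α j) (d j) with h | h
      · have hz : w j = 0 := by
          simp only [hwdef, hj, if_true]
          rw [max_eq_right (by linarith : α j - d j ≤ 0), zero_div]
        rw [hz]
        linarith
      · rw [max_eq_left (by linarith), max_eq_left (by linarith)] at h2
        linarith
    · simp [hwdef, hα'def, hj]
  have key := sum_weight_mul_le (w := w) (α := α') (d := d) (m := m) hw0 ?_ hd hf0 hm hm0 ?_ ?_ ?_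
  · have h1 := Finset.sum_le_sum fun j (_ : j ∈ Finset.univ) => hval j
    simp only [Finset.sum_sub_distrib, ← Finset.mul_sum] at h1
    linarith
  · intro j
    simp only [hα'def]
    split_ifs with h
    · linarith [hα j]
    · exact hα j
  · intro j
    simp only [hα'def]
    split_ifs with h
    · have h1 := hMm (M - d j) (by linarith [hd j])
      linarith [hd j]
    · exact hle _ j le_rfl
  · intro j t
    simp only [hα'def]
    split_ifs with h
    · linarith [hmM t]
    · linarith [hmM t]
  · intro l
    set t := α' l with ht
    -- The raised budget `M - d l` is an admissible time: the client attaining `M` has a budget of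
    -- at least `M`.
    have hex : ∃ i, t ≤ α i := by
      by_cases hl : α l + d l < M
      · obtain ⟨i, hi⟩ := hattain (by linarith [hα l, hd l])
        refine ⟨i, ?_⟩
        have : t = M - d l := by simp [ht, hα'def, hl]
        linarith [hd l, hd i]
      · exact ⟨l, by simp [ht, hα'def, hl]⟩
    obtain ⟨R, hR, hRj⟩ := hf t hex
    refine le_trans (Finset.sum_le_sum fun j _ => ?_) hR
    have hmR : ∀ r, 0 ≤ r → (∀ l, t ≤ α l → α l - d l - 2 * d j ≤ r) → m t - 2 * d j ≤ r :=
      fun r hr h => by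
        have := hmle t (r + 2 * d j) (by linarith [hd j]) fun l hl => by linarith [h l hl]
        linarith
    by_cases hj : α j + d j < M
    · obtain ⟨h0, h1, h2⟩ := hwbad j hj
      have e : α' j = M - d j := by simp [hα'def, hj]
      have hbound : ∀ r, r ≤ M - 2 * d j → w j * max r 0 ≤ max (α j - d j) 0 := fun r hr => by
        rw [← h2]
        exact mul_le_mul_of_nonneg_left (max_le_max hr le_rfl) h0
      by_cases hjt : α j < t
      · obtain ⟨hR0, hR1⟩ := hRj j hjt
        rw [if_pos hjt]
        by_cases hjt' : α' j < t
        · rw [if_pos hjt']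
          rcases hR1 with hR1 | hR1
          · exact (hbound _ (by linarith [hmM t])).trans (max_le hR1 hR0)
          · exact (mul_le_of_le_one_left (le_max_right _ _) h1).trans (max_le (hmR _ hR0 hR1) hR0)
        · rw [if_neg hjt']
          -- The true client has stopped but its replacement has not. The replacement's weighted
          -- offer is at most `(α j - d j)⁺`; in the connected case `m t ≥ M` shows that `R j`
          -- exceeds this too.
          have ht' : t ≤ M - d j := by rw [← e]; exact not_lt.1 hjt'
          refine (hbound _ (by linarith)).trans (max_le ?_ hR0)
          rcases hR1 with hR1 | hR1
          · exact hR1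
          · have h3 := hmR _ hR0 hR1
            have h4 := hMm t (by linarith [hd j])
            linarith
      · rw [if_neg hjt, if_neg (by rw [e]; linarith)]
        exact mul_le_of_le_one_left (le_max_right _ _) h1
    · have e : α' j = α j := by simp [hα'def, hj]
      have ew : w j = 1 := by simp [hwdef, hj]
      rw [e, ew, one_mul]
      split_ifs with hjt
      · obtain ⟨hR0, hR1⟩ := hRj j hjt
        refine max_le ?_ hR0
        rcases hR1 with hR1 | hR1
        -- Here `α j + d j ≥ M ≥ m t`, so the frozen offer is at least `m t - 2 d j`.
        · linarith [hmM t]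
        · exact hmR _ hR0 hR1
      · exact le_rfl

end Discrete

/-! ### Charging the budgets to the stars of a feasible solution -/

namespace FLPInstance

variable {X F C : Type*} [PseudoMetricSpace X] [Fintype C]

lemma Inv.budget_nonneg {I : FLPInstance X F C} {n : ℕ} [DecidableEq F] [DecidableEq C]
    {s : JMSState F C} (h : I.Reaches n s) (j : C) : 0 ≤ s.budget j := by
  induction h with
  | init => exact le_rfl
  | step _ hs ih =>
    obtain ⟨_, δ, hδ, _, he⟩ := hs
    rw [(event_cases he).2.1]
    simp only [JMSState.advance]
    split_ifs <;> linarith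

/-- The clients that a solution connects to the facility `i` pay for the facility and for their
distances within the bifactor. -/
lemma sum_fiber_budget_le [DecidableEq F] {I : FLPInstance X F C} {s : JMSState F C} {i : F}
    (h : I.Inv s) (h0 : ∀ j, 0 ≤ s.budget j) (hh : I.OfferHistory i s) (T : Finset C) :
    ∑ j ∈ T, s.budget j ≤ 111 / 100 * I.openCost i + 89 / 50 * ∑ j ∈ T, I.d i j := by
  have hd := I.d_nonneg i
  rw [← Finset.sum_coe_sort T, ← Finset.sum_coe_sort T (I.d i)]
  refine sum_budget_le (fun j => h0 j) (fun j => hd j) (I.openCost_nonneg i) ?_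
  rintro t ⟨l₀, hl₀⟩
  rcases hh t (hl₀.trans (h.budget_le_time l₀)) with ⟨_, hl⟩ | ⟨R, hR, hRj⟩
  -- With `i` already open, clients lasting until `t` stop within their distance to `i`, so no
  -- positive offer is needed from anyone.
  · refine ⟨fun _ => 0, ?_, fun j _ => ⟨le_rfl, Or.inr fun l htl => ?_⟩⟩
    · refine (Finset.sum_nonpos fun j _ => ?_).trans (I.openCost_nonneg i)
      split_ifs with hj
      · exact le_rfl
      · have := hl j (not_lt.1 hj)
        exact max_le (by linarith [not_lt.1 hj]) le_rfl
    · linarith [hl l htl, hd j]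
  · refine ⟨fun j => R j, ?_, fun j hj => ?_⟩
    · rw [Finset.sum_coe_sort T fun j => if s.budget j < t then R j else max (t - I.d i j) 0]
      -- Clients outside the star only add nonnegative offers.
      refine (Finset.sum_le_sum_of_subset_of_nonneg (Finset.subset_univ T) fun j _ _ => ?_).trans hR
      split_ifs with hj
      · exact (hRj j hj).1
      · exact le_max_right _ _
    · obtain ⟨hR0, hR1⟩ := hRj j hj
      refine ⟨hR0, hR1.imp_right ?_⟩
      rintro ⟨i', _, h1, h2⟩ l hl
      linarith [h2 l hl, I.d_le i i' j l]

/-- The clients are grouped by their assignment in `S`: the star bound for each opened facility, and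
budget at most penalty for the rejected ones, where the factor `1.78 ≥ 1` is given away. -/
lemma sum_budget_le_cost [Fintype F] [DecidableEq F] [DecidableEq C] {I : FLPInstance X F C}
    {n : ℕ} {s : JMSState F C} (hr : I.Reaches n s) {S : FLPSolution F C} (hS : S.Feasible) :
    ∑ j, s.budget j
      ≤ 1.11 * I.openingCost S + 1.78 * (I.connectionCost S + I.penaltyCost S) := by
  have h := Inv.of_reaches hr
  have h0 := Inv.budget_nonneg hr
  set fib : Option F → Finset C := fun o => Finset.univ.filter fun j => S.assign j = o with hfib
  have hsplit : ∀ g : C → ℝ, ∑ j, g j = ∑ j ∈ fib none, g j + ∑ i, ∑ j ∈ fib (some i), g j :=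
    fun g => by
      rw [← Finset.sum_fiberwise Finset.univ S.assign g, Fintype.sum_option]
  have hstar : ∀ i, ∑ j ∈ fib (some i), s.budget j
      ≤ 111 / 100 * (if i ∈ S.opened then I.openCost i else 0)
        + 89 / 50 * ∑ j ∈ fib (some i), I.d i j := fun i => by
    split_ifs with hi
    · exact sum_fiber_budget_le h h0 (OfferHistory.of_reaches hr i) _
    · have : fib (some i) = ∅ := by
        ext j
        simp only [hfib, Finset.mem_filter, Finset.mem_univ, true_and, Finset.notMem_empty,
          iff_false]
        exact fun hj => hi (hS j i hj)
      simp [this]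
  have hrej : ∑ j ∈ fib none, s.budget j ≤ ∑ j ∈ fib none, I.penalty j :=
    Finset.sum_le_sum fun j _ => h.budget_le_penalty j
  have hrej0 : 0 ≤ ∑ j ∈ fib none, I.penalty j :=
    Finset.sum_nonneg fun j _ => I.penalty_nonneg j
  have hopen : I.openingCost S = ∑ i, if i ∈ S.opened then I.openCost i else 0 := by
    simp [openingCost, Finset.sum_ite_mem]
  have hmem : ∀ o, ∀ j ∈ fib o, S.assign j = o := fun o j hj => by simpa [hfib] using hj
  have hconn : I.connectionCost S = ∑ i, ∑ j ∈ fib (some i), I.d i j := by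
    unfold connectionCost
    rw [hsplit, Finset.sum_eq_zero fun j hj => by simp [hmem none j hj], zero_add]
    exact Finset.sum_congr rfl fun i _ => Finset.sum_congr rfl fun j hj => by
      simp [hmem (some i) j hj]
  have hpen : I.penaltyCost S = ∑ j ∈ fib none, I.penalty j := by
    unfold penaltyCost
    rw [hsplit, Finset.sum_eq_zero (s := (Finset.univ : Finset F)), add_zero]
    · exact Finset.sum_congr rfl fun j hj => by simp [hmem none j hj]
    · exact fun i _ => Finset.sum_eq_zero fun j hj => by simp [hmem (some i) j hj]
  have hsum := Finset.sum_le_sum fun i (_ : i ∈ Finset.univ) => hstar i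
  rw [Finset.sum_add_distrib, ← Finset.mul_sum, ← Finset.mul_sum, ← hopen, ← hconn] at hsum
  rw [hsplit, hpen]
  norm_num
  linarith

end FLPInstance

theorem mainTheorem2 {X F C : Type*} [PseudoMetricSpace X] [Fintype F] [Fintype C]
    [DecidableEq F] [DecidableEq C] (I : FLPInstance X F C) :
    -- the algorithm never gets stuck while there is an active client
    (∀ n s, I.Reaches n s → s.active.Nonempty → ∃ s', I.Step s s') ∧
    -- every execution stops after at most `|F| + |C|` iterations
    (∀ n s, I.Reaches n s → n ≤ Fintype.card F + Fintype.card C) ∧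
    -- every returned solution is feasible and satisfies the bifactor bound
    (∀ A, I.Returns A → A.Feasible ∧
      ∀ S : FLPSolution F C, S.Feasible →
        I.cost A ≤ 1.11 * I.openingCost S + 1.78 * (I.connectionCost S + I.penaltyCost S)) := by
  refine ⟨fun n s hr hs => (FLPInstance.Inv.of_reaches hr).exists_step hs, fun n s hr => ?_, ?_⟩
  · have h1 := FLPInstance.reaches_card hr
    have h2 := Finset.card_le_univ s.opened
    omega
  · rintro A ⟨n, s, hr, ha, rfl⟩
    have h := FLPInstance.Inv.of_reaches hr
    refine ⟨fun j i hj => h.conn_opened j i hj, fun S hS => ?_⟩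
    rw [h.cost_eq ha]
    exact FLPInstance.sum_budget_le_cost hr hS
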